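/- **Setting.** Let $n\ge 1$, let $[p]$ be partitioned into $m$ disjoint groups $G_1,\dots,G_m$ of the same size $d$, and let $1\le s_0\le d$. Let $y=X\beta^*+\xi$, where $X\in\mathbb R^{n\times p}$, $\beta^*\in\mathbb R^p$, and the entries of $\xi\in\mathbb R^n$ are i.i.d. $\mathcal N(0,\sigma^2)$ with $\sigma>0$. Let $\gamma,\delta_0\in(0,1)$. Write $\|v\|_n^2=\frac1n\sum_{i=1}^n v_i^2$ for $v\in\mathbb R^n$. A vector $\beta\in\mathbb R^p$ is $(s,s_0)$-sparse if $\beta_{G_j}\neq 0$ for at most $s$ indices $j\in[m]$ and $\beta$ has at most $ss_0$ nonzero entries. **Weights and penalty.** For $j\in[m]$ put $$\lambda_j=\sigma\sqrt{\log\tfrac{2ed}{s_0}+\tfrac{2}{s_0}\log\tfrac{4em}{j}},$$ and for $i\in[p]$ put $\tilde\lambda_i=\lambda_{\lceil i/s_0\rceil}$ if $i\le s_0m$ and $\tilde\lambda_i=\lambda_m$ if $i>s_0m$. Let $\beta_{i^*}$ be the $i$-th largest of the numbers $|\beta_1|,\dots,|\beta_p|$ and $\|\beta_{G_{j^*}}\|_2$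 the $j$-th largest of $\|\beta_{G_1}\|_2,\dots,\|\beta_{G_m}\|_2$, and define $$\|\beta\|_*=\sum_{i=1}^p\tilde\lambda_i\,\beta_{i^*}+\sqrt{s_0}\sum_{j=1}^m\lambda_j\|\beta_{G_{j^*}}\|_2,\qquad N(\beta)=\frac1{\sqrt n}\|\beta\|_*.$$ A sparse group SLOPE estimator $\hat\beta$ is a minimiser over $\beta\in\mathbb R^p$ of $$\|y-X\beta\|_n^2+\frac{2(4+\sqrt2)}{\sqrt n\,\gamma}\|\beta\|_* ,$$ a criterion that does not involve $s$. **Restricted eigenvalue (WSGRE).** For $s\in[m]$ and $c_0>0$ let $$\theta(s,s_0,c_0)=\min_{\delta}\frac{\|X\delta\|_n}{\|\delta\|_2}\quad\text{over all }\delta\ne0\text{ with }\ \|\delta\|_*\le(2+c_0)\sqrt{\textstyle\sum_{i=1}^{ss_0}\tilde\lambda_i^2}\;\|\delta\|_2 .$$ Write $\theta_s=\theta\bigl(s,s_0,\tfrac{2(1+\gamma)}{1-\gamma}\bigr)$; the WSGRE condition at $s$ is $\theta_s>0$. Finally let $$\lambda^{\#}_s=\frac{(4+\sqrt2)\sigma}{\gamma\sqrt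 n}\sqrt{\log\tfrac{2ed}{s_0}+\tfrac2{s_0}\log\tfrac{4em}{s}},\qquad \delta(\lambda)=\exp\Bigl(-\Bigl(\frac{\gamma\lambda\sqrt n}{(4+\sqrt2)\sigma}\Bigr)^2\Bigr).$$ **Theorem.** There is an absolute constant $C\in(1,2)$ such that the following holds in the setting above. Assume that $$\mathbf P\Bigl\{\sup_{u\in\mathbb R^p:\,N(u)\le1}\bigl|\tfrac1n\xi^{T}Xu\bigr|\le4\Bigr\}\ge\tfrac12 .$$ Then there is an event of probability at least $1-\delta_0/2$ on which every sparse group SLOPE estimator $\hat\beta$ satisfies, simultaneously for all $s\in[m]$ such that $\beta^*$ is $(s,s_0)$-sparse and $\theta_s>0$, $$\|\hat\beta-\beta^*\|_2\le(1+\gamma)\sqrt{ss_0}\,\lambda^{\#}_s\,\max\left\{\frac{2C}{\theta_s^2},\ \frac12\cdot\frac{\log(1/\delta_0)}{\log(1/\delta(\lambda^{\#}_s))\,ss_0}\right\}.$$ -/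

import Mathlib

open Matrix MeasureTheory ProbabilityTheory

noncomputable section

namespace SGSlope

/-- The entries of `f` in decreasing order: `sortedDesc f i` is the `(i+1)`-th largest of the
values of `f` (the index `i : Fin k` starts at `0`), counted with multiplicity. -/
def sortedDesc {k : ℕ} (f : Fin k → ℝ) (i : Fin k) : ℝ :=
  f (Tuple.sort f i.rev)

/-- The empirical norm `‖v‖ₙ = ((1/n) ∑ᵢ vᵢ²)^{1/2}` on `ℝⁿ`. -/
def empNorm {n : ℕ} (v : Fin n → ℝ) : ℝ :=
  Real.sqrt ((1 / (n : ℝ)) * ∑ i, v i ^ 2)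

/-- `G 0, …, G (m-1)` are pairwise disjoint groups of `d` indices each whose union is the whole
index set. -/
structure IsGrouping {p m : ℕ} (d : ℕ) (G : Fin m → Finset (Fin p)) : Prop where
  pairwise_disjoint : ∀ j k, j ≠ k → Disjoint (G j) (G k)
  exists_mem : ∀ i, ∃ j, i ∈ G j
  card_eq : ∀ j, (G j).card = d

/-- The Euclidean norm of the subvector `β_{G_j}`. -/
def groupNorm {p m : ℕ} (G : Fin m → Finset (Fin p)) (β : EuclideanSpace ℝ (Fin p))
    (j : Fin m) : ℝ :=
  Real.sqrt (∑ i ∈ G j, β i ^ 2)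

/-- `β` is `(s, s₀)`-sparse: at most `s` groups `G_j` with `β_{G_j} ≠ 0`, and at most `s s₀`
nonzero entries. -/
def IsDoubleSparse {p m : ℕ} (G : Fin m → Finset (Fin p)) (s s₀ : ℕ)
    (β : EuclideanSpace ℝ (Fin p)) : Prop :=
  {j : Fin m | ∃ i ∈ G j, β i ≠ 0}.ncard ≤ s ∧ {i : Fin p | β i ≠ 0}.ncard ≤ s * s₀

/-- The sorted `ℓ₁` norm `∑ᵢ wᵢ |β|₍ᵢ₎`, where `|β|₍₁₎ ≥ |β|₍₂₎ ≥ …` are the sorted absolute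
values of the entries; the weights `w 1, w 2, …` are numbered from `1`. -/
def sortedL1 {p : ℕ} (w : ℕ → ℝ) (β : EuclideanSpace ℝ (Fin p)) : ℝ :=
  ∑ i : Fin p, w (i + 1) * sortedDesc (fun l => |β l|) i

/-- The sorted group norm `∑ⱼ wⱼ ‖β_{G_{j*}}‖₂`, where `‖β_{G_{j*}}‖₂` is the `j`-th largest of the
group norms; the weights `w 1, w 2, …` are numbered from `1`. -/
def sortedGroup {p m : ℕ} (G : Fin m → Finset (Fin p)) (w : ℕ → ℝ)
    (β : EuclideanSpace ℝ (Fin p)) : ℝ :=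
  ∑ j : Fin m, w (j + 1) * sortedDesc (groupNorm G β) j

/-- The weights `λ_j = σ √(log(2ed/s₀) + (2/s₀) log(4em/j))`, `j = 1, …, m`. -/
def lam (σ : ℝ) (d m s₀ : ℕ) (j : ℕ) : ℝ :=
  σ * Real.sqrt (Real.log (2 * Real.exp 1 * d / s₀)
    + 2 / s₀ * Real.log (4 * Real.exp 1 * m / j))

/-- The extended weights: `λ̃_i = λ_{⌈i/s₀⌉}` for `i ≤ s₀ m` and `λ̃_i = λ_m` for `i > s₀ m`. -/
def lamTilde (σ : ℝ) (d m s₀ : ℕ) (i : ℕ) : ℝ :=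
  if i ≤ s₀ * m then lam σ d m s₀ (i ⌈/⌉ s₀) else lam σ d m s₀ m

/-- The sorted double penalty `‖β‖_* = ‖β‖_{λ̃*} + √s₀ ‖β‖_{G,λ*}`. -/
def starNorm {p m : ℕ} (G : Fin m → Finset (Fin p)) (σ : ℝ) (d s₀ : ℕ)
    (β : EuclideanSpace ℝ (Fin p)) : ℝ :=
  sortedL1 (lamTilde σ d m s₀) β + Real.sqrt s₀ * sortedGroup G (lam σ d m s₀) β

/-- The function
`N(u) = n^{-1/2} (∑ⱼ ‖U_{j*}‖₂ √s₀ λ_j + ∑ᵢ u_{i*} λ̃_i)`. -/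
def envelope {p m : ℕ} (n : ℕ) (G : Fin m → Finset (Fin p)) (σ : ℝ) (d s₀ : ℕ)
    (u : EuclideanSpace ℝ (Fin p)) : ℝ :=
  1 / Real.sqrt n *
    ((∑ j : Fin m, sortedDesc (groupNorm G u) j * (Real.sqrt s₀ * lam σ d m s₀ (j + 1)))
      + ∑ i : Fin p, sortedDesc (fun l => |u l|) i * lamTilde σ d m s₀ (i + 1))

/-- For the noise vector `x ∈ ℝⁿ`, the inequality `sup_{N(u) ≤ 1} |xᵀ X u / n| ≤ 4`. -/
def NoiseEvent {n p m : ℕ} (X : Matrix (Fin n) (Fin p) ℝ) (G : Fin m → Finset (Fin p))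
    (σ : ℝ) (d s₀ : ℕ) (x : Fin n → ℝ) : Prop :=
  ∀ u : EuclideanSpace ℝ (Fin p), envelope n G σ d s₀ u ≤ 1 →
    |1 / (n : ℝ) * (x ⬝ᵥ (X *ᵥ u.ofLp))| ≤ 4

/-- The cone of all `δ` with `‖δ‖_* ≤ (2 + c₀) (∑_{i ≤ s s₀} λ̃_i²)^{1/2} ‖δ‖₂`. -/
def wsgreCone {p m : ℕ} (G : Fin m → Finset (Fin p)) (σ : ℝ) (d s s₀ : ℕ) (c₀ : ℝ) :
    Set (EuclideanSpace ℝ (Fin p)) :=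
  {δ | starNorm G σ d s₀ δ
    ≤ (2 + c₀) * Real.sqrt (∑ i ∈ Finset.Icc 1 (s * s₀), lamTilde σ d m s₀ i ^ 2) * ‖δ‖}

/-- The restricted eigenvalue: the infimum of `‖Xδ‖ₙ / ‖δ‖₂` over the nonzero vectors of the
cone. -/
def theta {n p m : ℕ} (X : Matrix (Fin n) (Fin p) ℝ) (G : Fin m → Finset (Fin p))
    (σ : ℝ) (d s s₀ : ℕ) (c₀ : ℝ) : ℝ :=
  sInf ((fun δ : EuclideanSpace ℝ (Fin p) => empNorm (X *ᵥ δ.ofLp) / ‖δ‖) ''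
    (wsgreCone G σ d s s₀ c₀ \ {0}))

/-- The sparse group SLOPE penalty `h(β) = (2(4+√2)/(√n γ)) ‖β‖_*`; it does not involve the group
sparsity `s`. -/
def penalty {p m : ℕ} (n : ℕ) (G : Fin m → Finset (Fin p)) (σ γ : ℝ) (d s₀ : ℕ)
    (β : EuclideanSpace ℝ (Fin p)) : ℝ :=
  2 * (4 + Real.sqrt 2) / (Real.sqrt n * γ) * starNorm G σ d s₀ β

/-- `b` is a sparse group SLOPE estimator for the response `y`: a minimiser over all of `ℝᵖ` of
`‖y - Xβ‖ₙ² + h(β)`. -/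
def IsSparseGroupSlope {n p m : ℕ} (X : Matrix (Fin n) (Fin p) ℝ) (G : Fin m → Finset (Fin p))
    (σ γ : ℝ) (d s₀ : ℕ) (y : Fin n → ℝ) (b : EuclideanSpace ℝ (Fin p)) : Prop :=
  IsMinOn (fun β : EuclideanSpace ℝ (Fin p) =>
    empNorm (y - X *ᵥ β.ofLp) ^ 2 + penalty n G σ γ d s₀ β) Set.univ b

/-- `λ^♯ = ((4+√2)σ/(γ√n)) √(log(2ed/s₀) + (2/s₀) log(4em/s))`. -/
def lamSharp (σ γ : ℝ) (n d m s s₀ : ℕ) : ℝ :=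
  (4 + Real.sqrt 2) * σ / (γ * Real.sqrt n) *
    Real.sqrt (Real.log (2 * Real.exp 1 * d / s₀)
      + 2 / s₀ * Real.log (4 * Real.exp 1 * m / s))

/-- `δ(l) = exp(-(γ l √n / ((4+√2)σ))²)`. -/
def deltaOf (σ γ : ℝ) (n : ℕ) (l : ℝ) : ℝ :=
  Real.exp (-(γ * l * Real.sqrt n / ((4 + Real.sqrt 2) * σ)) ^ 2)

end SGSlope

end

noncomputable section

namespace SGSlope

/-! Noise. By homogeneity the hypothesis says that the set K of vectors z with |zᵀXu|/n ≤ 4N(u) for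
all u has Gaussian measure at least 1/2. Gaussian concentration puts ξ within Euclidean distance
σ√(8 log(1/δ₀)) of K outside an event of probability at most δ₀/2. It is derived from
Prékopa–Leindler on the line, which gives Maurey's property (τ); this tensorises
(`pi_gaussianReal_property_tau`) and is tested on two-valued functions
(`pi_gaussianReal_enlargement`). On the good event Cauchy–Schwarz yields ξᵀXu/n ≤ 4N(u) + τ‖Xu‖ₙ for
all u, with τ² = 8σ² log(1/δ₀)/n. Neither s nor the estimator enters this event, hence the
simultaneity.

Deterministic part. Put u = β̂ − β*, S = ‖u‖_*, E = ‖Xu‖ₙ, r = ‖u‖₂, κ = (4+√2)/(γ√n). First-order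
optimality gives E² ≤ ξᵀXu/n + κ(‖β*‖_* − ‖β̂‖_*), and 4N(u) ≤ (3/4)γκS because 4+√2 > 16/3.
Sparsity of β* gives ‖β*‖_* − ‖β̂‖_* ≤ 2H − S, where H is the head of the penalty of u. Moreover H ≤
2Λr, where Λ² = ∑_{i ≤ ss₀} λ̃ᵢ² and Λ ≤ (5/4)√(ss₀) λ_s.

Let T₁, T₂ be the two terms of the claimed maximum. In the cone, E ≥ θr leads to r ≤ τ/θ + (2/3)T₁,
and τ/θ ≤ √(T₁T₂)/4. Off the cone the penalty gains −κγS, which beats the noise term; completing the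
square gives γκS ≤ τ², hence r ≤ T₂ without any eigenvalue (`error_le_max`). -/

/-! ### Brunn–Minkowski and Prékopa–Leindler on the line -/

/-- One-dimensional Brunn–Minkowski inequality for compact sets. -/
lemma volume_add_le_of_isCompact {K L C : Set ℝ} (hK : IsCompact K) (hL : IsCompact L)
    (hK0 : K.Nonempty) (hL0 : L.Nonempty) (h : ∀ x ∈ K, ∀ y ∈ L, x + y ∈ C) :
    volume K + volume L ≤ volume C := by
  -- With `a` the maximum of K and `b` the minimum of L, the translates K + b and a + L lie in C on
  -- opposite sides of a + b, so they share only that point.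
  obtain ⟨a, haK, ha⟩ := hK.exists_isGreatest hK0
  obtain ⟨b, hbL, hb⟩ := hL.exists_isLeast hL0
  have h1 : volume ((fun x => x + -b) ⁻¹' K) = volume K := measure_preimage_add_right _ _ _
  have h2 : volume ((fun x => x + -a) ⁻¹' L) = volume L := measure_preimage_add_right _ _ _
  have hm : MeasurableSet ((fun x => x + -a) ⁻¹' L) :=
    (measurable_add_const (-a)) hL.measurableSet
  have hd : AEDisjoint volume ((fun x => x + -b) ⁻¹' K) ((fun x => x + -a) ⁻¹' L) := by
    refine measure_mono_null (t := {a + b}) ?_ (by simp)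
    rintro x ⟨hx1, hx2⟩
    have := ha hx1
    have := hb hx2
    simp only [Set.mem_singleton_iff]
    simp only at *
    linarith
  rw [← h1, ← h2, ← measure_union₀ hm.nullMeasurableSet hd]
  refine measure_mono ?_
  rintro x (hx | hx)
  · simpa using h _ hx _ hbL
  · simpa using h _ haK _ hx

/-- One-dimensional Brunn–Minkowski inequality. -/
lemma volume_add_le {A B C : Set ℝ} (hA : MeasurableSet A) (hB : MeasurableSet B)
    (hA0 : A.Nonempty) (hB0 : B.Nonempty) (h : ∀ x ∈ A, ∀ y ∈ B, x + y ∈ C) :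
    volume A + volume B ≤ volume C := by
  obtain ⟨a, ha⟩ := hA0
  obtain ⟨b, hb⟩ := hB0
  rw [hA.measure_eq_iSup_isCompact, hB.measure_eq_iSup_isCompact]
  simp only [iSup_and']
  refine ENNReal.biSup_add_biSup_le' (p := fun K => K ⊆ A ∧ IsCompact K)
    (q := fun K => K ⊆ B ∧ IsCompact K) ⟨∅, by simp⟩ ⟨∅, by simp⟩ ?_
  rintro K ⟨hKA, hK⟩ L ⟨hLB, hL⟩
  -- Adjoining `a` and `b` keeps the approximating sets compact and makes them nonempty, as the
  -- compact case requires.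
  refine le_trans (add_le_add (measure_mono (Set.subset_insert a K))
    (measure_mono (Set.subset_insert b L))) ?_
  refine volume_add_le_of_isCompact (hK.insert a) (hL.insert b) (Set.insert_nonempty _ _)
    (Set.insert_nonempty _ _) fun x hx y hy => h x ?_ y ?_
  · exact Set.insert_subset ha hKA hx
  · exact Set.insert_subset hb hLB hy

lemma volume_midpoint {A B C : Set ℝ} (hA : MeasurableSet A) (hB : MeasurableSet B)
    (hA0 : A.Nonempty) (hB0 : B.Nonempty) (h : ∀ x ∈ A, ∀ y ∈ B, (x + y) / 2 ∈ C) :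
    volume A + volume B ≤ 2 * volume C := by
  have h1 : volume ((fun x : ℝ => (1 / 2 : ℝ) * x) ⁻¹' C) = 2 * volume C := by
    rw [Real.volume_preimage_mul_left (by norm_num)]
    norm_num
  rw [← h1]
  refine volume_add_le hA hB hA0 hB0 fun x hx y hy => ?_
  have := h x hx y hy
  rw [Set.mem_preimage]
  convert this using 1
  ring

/-- Layer-cake: for t < 1 the sets {F > t} and {G > t} are both nonempty because the two suprema are
equal to 1, and their midpoints lie in {H > t}, so Brunn–Minkowski applies level by level. For t ≥ 1
the left side vanishes. -/
lemma prekopaLeindler_of_isLUB {F G H : ℝ → ℝ} (hF : Measurable F) (hG : Measurable G)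
    (hH : Measurable H) (hF0 : ∀ x, 0 ≤ F x) (hG0 : ∀ x, 0 ≤ G x) (hH0 : ∀ x, 0 ≤ H x)
    (hF1 : IsLUB (Set.range F) 1) (hG1 : IsLUB (Set.range G) 1)
    (h : ∀ x y, F x * G y ≤ H ((x + y) / 2) ^ 2) :
    (∫⁻ x, ENNReal.ofReal (F x)) + ∫⁻ x, ENNReal.ofReal (G x)
      ≤ 2 * ∫⁻ x, ENNReal.ofReal (H x) := by
  rw [lintegral_eq_lintegral_meas_lt _ (.of_forall hF0) hF.aemeasurable,
    lintegral_eq_lintegral_meas_lt _ (.of_forall hG0) hG.aemeasurable,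
    lintegral_eq_lintegral_meas_lt _ (.of_forall hH0) hH.aemeasurable,
    ← lintegral_const_mul' _ _ (by norm_num)]
  have hanti : Antitone fun t => volume {a | t < G a} :=
    fun s t hst => measure_mono fun x hx => lt_of_le_of_lt hst hx
  rw [← lintegral_add_right _ hanti.measurable]
  refine setLIntegral_mono' measurableSet_Ioi fun t ht => ?_
  have ht0 : (0 : ℝ) < t := ht
  by_cases ht1 : t < 1
  · obtain ⟨_, ⟨x, rfl⟩, hx⟩ := (lt_isLUB_iff hF1).1 ht1
    obtain ⟨_, ⟨y, rfl⟩, hy⟩ := (lt_isLUB_iff hG1).1 ht1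
    refine volume_midpoint (measurableSet_lt measurable_const hF)
      (measurableSet_lt measurable_const hG) ⟨x, hx⟩ ⟨y, hy⟩ fun x hx y hy => ?_
    simp only [Set.mem_ofPred_eq] at *
    refine lt_of_pow_lt_pow_left₀ 2 (hH0 _) (lt_of_lt_of_le ?_ (h x y))
    nlinarith
  · have e1 : {a | t < F a} = ∅ := Set.eq_empty_iff_forall_notMem.2 fun x hx =>
      ht1 (lt_of_lt_of_le hx (hF1.1 ⟨x, rfl⟩))
    have e2 : {a | t < G a} = ∅ := Set.eq_empty_iff_forall_notMem.2 fun x hx =>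
      ht1 (lt_of_lt_of_le hx (hG1.1 ⟨x, rfl⟩))
    simp [e1, e2]

lemma isLUB_div_sSup {F : ℝ → ℝ} (hb : BddAbove (Set.range F))
    (h : 0 < sSup (Set.range F)) : IsLUB (Set.range fun x => F x / sSup (Set.range F)) 1 := by
  have hl := isLUB_csSup (Set.range_nonempty F) hb
  refine ⟨?_, fun c hc => ?_⟩
  · rintro _ ⟨x, rfl⟩
    exact (div_le_one h).2 (hl.1 ⟨x, rfl⟩)
  · by_contra hlt
    push Not at hlt
    have : sSup (Set.range F) ≤ c * sSup (Set.range F) := hl.2 (by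
      rintro _ ⟨x, rfl⟩
      exact (div_le_iff₀ h).1 (hc ⟨x, rfl⟩))
    nlinarith

lemma four_mul_le_sq_add_ennreal (a b : ENNReal) : 4 * (a * b) ≤ (a + b) ^ 2 := by
  rcases eq_or_ne a ⊤ with rfl | ha
  · simp [ENNReal.top_pow]
  rcases eq_or_ne b ⊤ with rfl | hb
  · simp [ENNReal.top_pow]
  lift a to NNReal using ha
  lift b to NNReal using hb
  norm_cast
  rw [← NNReal.coe_le_coe]
  push_cast
  nlinarith [sq_nonneg ((a : ℝ) - b)]

/-- The Prékopa–Leindler inequality on the line, with weights `1/2`. -/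
theorem prekopaLeindler_real {F G H : ℝ → ℝ} (hF : Measurable F) (hG : Measurable G)
    (hH : Measurable H) (hF0 : ∀ x, 0 ≤ F x) (hG0 : ∀ x, 0 ≤ G x) (hH0 : ∀ x, 0 ≤ H x)
    (hFb : BddAbove (Set.range F)) (hGb : BddAbove (Set.range G))
    (h : ∀ x y, F x * G y ≤ H ((x + y) / 2) ^ 2) :
    (∫⁻ x, ENNReal.ofReal (F x)) * ∫⁻ x, ENNReal.ofReal (G x)
      ≤ (∫⁻ x, ENNReal.ofReal (H x)) ^ 2 := by
  set a := sSup (Set.range F) with ha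
  set b := sSup (Set.range G) with hb
  have hFa : ∀ x, F x ≤ a := fun x => le_csSup hFb ⟨x, rfl⟩
  have hGa : ∀ x, G x ≤ b := fun x => le_csSup hGb ⟨x, rfl⟩
  rcases le_or_gt a 0 with ha0 | ha0
  · have : ∀ x, F x = 0 := fun x => le_antisymm ((hFa x).trans ha0) (hF0 x)
    simp [this]
  rcases le_or_gt b 0 with hb0 | hb0
  · have : ∀ x, G x = 0 := fun x => le_antisymm ((hGa x).trans hb0) (hG0 x)
    simp [this]
  set c := Real.sqrt (a * b) with hc
  have hc0 : 0 < c := Real.sqrt_pos.2 (mul_pos ha0 hb0)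
  have hcc : c ^ 2 = a * b := Real.sq_sqrt (mul_pos ha0 hb0).le
  -- Dividing by the suprema makes both superlevel sets nonempty for the same levels; the resulting
  -- additive bound becomes multiplicative by 4xy ≤ (x + y)².
  have key := prekopaLeindler_of_isLUB (F := fun x => F x / a) (G := fun x => G x / b)
    (H := fun x => H x / c) (hF.div_const _) (hG.div_const _) (hH.div_const _)
    (fun x => div_nonneg (hF0 x) ha0.le) (fun x => div_nonneg (hG0 x) hb0.le)
    (fun x => div_nonneg (hH0 x) hc0.le) (isLUB_div_sSup hFb ha0) (isLUB_div_sSup hGb hb0)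
    (fun x y => by
      rw [div_pow, hcc, div_mul_div_comm]
      exact div_le_div_of_nonneg_right (h x y) (mul_pos ha0 hb0).le)
  have scale : ∀ (f : ℝ → ℝ) (r : ℝ), 0 < r →
      ∫⁻ x, ENNReal.ofReal (f x) = ENNReal.ofReal r * ∫⁻ x, ENNReal.ofReal (f x / r) := by
    intro f r hr
    rw [← lintegral_const_mul' _ _ ENNReal.ofReal_ne_top]
    refine lintegral_congr fun x => ?_
    rw [← ENNReal.ofReal_mul hr.le, mul_div_cancel₀ _ hr.ne']
  rw [scale F a ha0, scale G b hb0, scale H c hc0]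
  set IF := ∫⁻ x, ENNReal.ofReal (F x / a)
  set IG := ∫⁻ x, ENNReal.ofReal (G x / b)
  set IH := ∫⁻ x, ENNReal.ofReal (H x / c)
  have h4 : 4 * (IF * IG) ≤ 4 * IH ^ 2 := by
    calc 4 * (IF * IG) ≤ (IF + IG) ^ 2 := four_mul_le_sq_add_ennreal _ _
      _ ≤ (2 * IH) ^ 2 := by gcongr
      _ = 4 * IH ^ 2 := by ring
  have h5 : IF * IG ≤ IH ^ 2 := by
    rwa [ENNReal.mul_le_mul_iff_right (by norm_num) (by norm_num)] at h4
  calc ENNReal.ofReal a * IF * (ENNReal.ofReal b * IG)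
      = ENNReal.ofReal a * ENNReal.ofReal b * (IF * IG) := by ring
    _ ≤ ENNReal.ofReal a * ENNReal.ofReal b * IH ^ 2 := by gcongr
    _ = (ENNReal.ofReal c * IH) ^ 2 := by
        rw [mul_pow, ← ENNReal.ofReal_pow hc0.le, hcc, ENNReal.ofReal_mul ha0.le]

/-! ### Property (τ) and Gaussian concentration -/

/-- Maurey's property (τ) for the centred Gaussian law on the line. -/
lemma gaussianReal_property_tau {v : NNReal} (hv : v ≠ 0) {f g : ℝ → ENNReal}
    (hf : Measurable f) (hg : Measurable g) {M : NNReal} (hfM : ∀ x, f x ≤ M)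
    (hgM : ∀ x, g x ≤ M) {κ : NNReal}
    (h : ∀ x y, f x * g y ≤ κ * ENNReal.ofReal (Real.exp ((x - y) ^ 2 / (4 * v)))) :
    (∫⁻ x, f x ∂gaussianReal 0 v) * ∫⁻ x, g x ∂gaussianReal 0 v ≤ κ := by
  set φ := gaussianPDFReal 0 v with hφ
  have hφ0 : ∀ x, 0 ≤ φ x := gaussianPDFReal_nonneg 0 v
  have hφm : Measurable φ := measurable_gaussianPDFReal 0 v
  have hft : ∀ x, f x ≠ ⊤ := fun x => ne_top_of_le_ne_top ENNReal.coe_ne_top (hfM x)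
  have hgt : ∀ x, g x ≠ ⊤ := fun x => ne_top_of_le_ne_top ENNReal.coe_ne_top (hgM x)
  have hv0 : (0 : ℝ) < v := lt_of_le_of_ne v.2 (by exact_mod_cast hv.symm)
  have conv : ∀ k : ℝ → ENNReal, Measurable k → (∀ x, k x ≠ ⊤) →
      ∫⁻ x, k x ∂gaussianReal 0 v = ∫⁻ x, ENNReal.ofReal ((k x).toReal * φ x) := by
    intro k hk hkt
    rw [gaussianReal_of_var_ne_zero _ hv,
      lintegral_withDensity_eq_lintegral_mul _ (measurable_gaussianPDF 0 v) hk]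
    refine lintegral_congr fun x => ?_
    rw [ENNReal.ofReal_mul ENNReal.toReal_nonneg, ENNReal.ofReal_toReal (hkt x), mul_comm]
    rfl
  have hφb : ∀ x, φ x ≤ (Real.sqrt (2 * Real.pi * v))⁻¹ := by
    intro x
    simp only [hφ, gaussianPDFReal]
    refine mul_le_of_le_one_right (by positivity) (Real.exp_le_one_iff.2 ?_)
    rw [neg_div]
    exact neg_nonpos.2 (by positivity)
  have bdd : ∀ k : ℝ → ENNReal, (∀ x, k x ≤ M) →
      BddAbove (Set.range fun x => (k x).toReal * φ x) := by
    intro k hk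
    refine ⟨M * (Real.sqrt (2 * Real.pi * v))⁻¹, ?_⟩
    rintro _ ⟨x, rfl⟩
    exact mul_le_mul (ENNReal.toReal_le_coe_of_le_coe (hk x)) (hφb x) (hφ0 x) M.2
  rw [conv f hf hft, conv g hg hgt]
  have hone : ∫⁻ x, ENNReal.ofReal (Real.sqrt κ * φ x) = ENNReal.ofReal (Real.sqrt κ) := by
    simp_rw [ENNReal.ofReal_mul (Real.sqrt_nonneg (κ : ℝ))]
    rw [lintegral_const_mul' _ _ ENNReal.ofReal_ne_top]
    have := lintegral_gaussianPDFReal_eq_one 0 hv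
    rw [this, mul_one]
  refine (prekopaLeindler_real (H := fun x => Real.sqrt κ * φ x)
    (hf.ennreal_toReal.mul hφm) (hg.ennreal_toReal.mul hφm) (hφm.const_mul _)
    (fun x => mul_nonneg ENNReal.toReal_nonneg (hφ0 x))
    (fun x => mul_nonneg ENNReal.toReal_nonneg (hφ0 x))
    (fun x => mul_nonneg (Real.sqrt_nonneg _) (hφ0 x)) (bdd f hfM) (bdd g hgM) ?_).trans ?_
  · intro x y
    have h1 : (f x).toReal * (g y).toReal ≤ κ * Real.exp ((x - y) ^ 2 / (4 * v)) := by
      have := ENNReal.toReal_mono (by finiteness) (h x y)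
      simpa [ENNReal.toReal_mul, ENNReal.toReal_ofReal (Real.exp_pos _).le] using this
    -- This is the identity x² + y² = (x + y)²/2 + (x − y)²/2: the cost (x − y)²/(4v) is exactly the
    -- midpoint defect of the Gaussian exponent.
    have h2 : Real.exp ((x - y) ^ 2 / (4 * v)) * (φ x * φ y) = φ ((x + y) / 2) ^ 2 := by
      have e : ∀ A B C D r : ℝ, A + (B + C) = D + D →
          Real.exp A * (r * Real.exp B * (r * Real.exp C)) = (r * Real.exp D) ^ 2 := by
        intro A B C D r hh
        have : Real.exp A * (Real.exp B * Real.exp C) = Real.exp D * Real.exp D := by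
          rw [← Real.exp_add, ← Real.exp_add, ← Real.exp_add, hh]
        linear_combination r ^ 2 * this
      simp only [hφ, gaussianPDFReal]
      apply e
      field_simp
      ring
    calc (f x).toReal * φ x * ((g y).toReal * φ y)
        = ((f x).toReal * (g y).toReal) * (φ x * φ y) := by ring
      _ ≤ (κ * Real.exp ((x - y) ^ 2 / (4 * v))) * (φ x * φ y) :=
          mul_le_mul_of_nonneg_right h1 (mul_nonneg (hφ0 x) (hφ0 y))
      _ = (Real.sqrt κ * φ ((x + y) / 2)) ^ 2 := by
          rw [mul_assoc, h2, mul_pow, Real.sq_sqrt κ.coe_nonneg]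
  · rw [hone, ← ENNReal.ofReal_pow (Real.sqrt_nonneg _), Real.sq_sqrt κ.coe_nonneg]
    simp

/-- Maurey's property (τ) for a product of centred Gaussian laws. -/
theorem pi_gaussianReal_property_tau {v : NNReal} (hv : v ≠ 0) (M : NNReal) (n : ℕ) :
    ∀ (κ : NNReal) (f g : (Fin n → ℝ) → ENNReal), Measurable f → Measurable g →
      (∀ x, f x ≤ M) → (∀ x, g x ≤ M) →
      (∀ x y, f x * g y ≤ κ * ENNReal.ofReal (Real.exp ((∑ i, (x i - y i) ^ 2) / (4 * v)))) →
      (∫⁻ x, f x ∂Measure.pi fun _ => gaussianReal 0 v) *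
        ∫⁻ x, g x ∂Measure.pi (fun _ => gaussianReal 0 v) ≤ κ := by
  induction n with
  | zero =>
    intro κ f g hf hg _ _ h
    have e : ∀ k : (Fin 0 → ℝ) → ENNReal,
        ∫⁻ x, k x ∂Measure.pi (fun _ : Fin 0 => gaussianReal 0 v) = k 0 := by
      intro k
      have : ∀ x, k x = k 0 := fun x => by rw [Subsingleton.elim x 0]
      simp_rw [this]
      simp
    rw [e, e]
    simpa using h 0 0
  | succ n ih =>
    intro κ f g hf hg hfM hgM h
    set ν := Measure.pi fun _ : Fin n => gaussianReal 0 v with hν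
    have hmp := (measurePreserving_piFinSuccAbove
      (fun _ : Fin (n + 1) => gaussianReal 0 v) 0).symm
    have hcm : Measurable fun q : ℝ × (Fin n → ℝ) => (Fin.cons q.1 q.2 : Fin (n + 1) → ℝ) := by
      refine measurable_pi_lambda _ fun i => ?_
      refine Fin.cases ?_ (fun i => ?_) i
      · simpa using measurable_fst
      · simp only [Fin.cons_succ]
        fun_prop
    have e : ∀ k : (Fin (n + 1) → ℝ) → ENNReal, Measurable k →
        ∫⁻ x, k x ∂Measure.pi (fun _ : Fin (n + 1) => gaussianReal 0 v)
          = ∫⁻ a, ∫⁻ b, k (Fin.cons a b) ∂ν ∂gaussianReal 0 v := by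
      intro k hk
      rw [← hmp.lintegral_comp hk]
      have := lintegral_prod (μ := gaussianReal 0 v) (ν := ν)
        (fun q : ℝ × (Fin n → ℝ) => k (Fin.cons q.1 q.2)) (hk.comp hcm).aemeasurable
      simp only [MeasurableEquiv.piFinSuccAbove_symm_apply, Fin.insertNthEquiv_zero]
      exact this
    rw [e f hf, e g hg]
    refine gaussianReal_property_tau (M := M) hv (hf.comp hcm).lintegral_prod_right'
      (hg.comp hcm).lintegral_prod_right' ?_ ?_ fun a a' => ?_
    · intro a
      refine (lintegral_mono fun b => hfM _).trans ?_
      simp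
    · intro a
      refine (lintegral_mono fun b => hgM _).trans ?_
      simp
    -- For fixed first coordinates, their share of the cost is absorbed into the constant; the bound
    -- so obtained for the partial integrals is the hypothesis of the one-dimensional case. This is
    -- why κ is quantified inside the induction.
    · have := ih (κ * (Real.exp ((a - a') ^ 2 / (4 * v))).toNNReal)
        (fun b => f (Fin.cons a b)) (fun b => g (Fin.cons a' b))
        (hf.comp (hcm.comp measurable_prodMk_left))
        (hg.comp (hcm.comp measurable_prodMk_left)) (fun _ => hfM _) (fun _ => hgM _)
        fun x y => by
          refine (h _ _).trans (le_of_eq ?_)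
          rw [Fin.sum_univ_succ]
          simp only [Fin.cons_zero, Fin.cons_succ]
          rw [add_div, Real.exp_add, ENNReal.ofReal_mul (Real.exp_pos _).le, ENNReal.coe_mul,
            mul_assoc]
          rfl
      refine this.trans (le_of_eq ?_)
      rw [ENNReal.coe_mul]
      rfl

/-- A set of Gaussian measure at least `1/2` carries, after enlargement by `t` in the Euclidean
distance, all but at most `exp (-t² / (8v)) / 2` of the mass. -/
theorem pi_gaussianReal_enlargement {v : NNReal} (hv : v ≠ 0) {n : ℕ} {K D : Set (Fin n → ℝ)}
    (hK : MeasurableSet K) (hD : MeasurableSet D) {t : ℝ}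
    (ht : 0 < t)
    (hdist : ∀ x ∈ D, ∀ y ∈ K, t ^ 2 ≤ ∑ i, (x i - y i) ^ 2)
    (hhalf : 1 / 2 ≤ (Measure.pi fun _ => gaussianReal 0 v).real K) :
    (Measure.pi fun _ => gaussianReal 0 v).real D ≤ 1 / 2 * Real.exp (-(t ^ 2 / (8 * v))) := by
  set ν := Measure.pi fun _ : Fin n => gaussianReal 0 v with hν
  have hv0 : (0 : ℝ) < v := lt_of_le_of_ne v.2 (by exact_mod_cast hv.symm)
  set z := Real.exp (t ^ 2 / (4 * v)) with hz
  have hz1 : 1 ≤ z := Real.one_le_exp (by positivity)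
  classical
  -- `f` is z on D and 1 elsewhere; `g` is 1 on K and z⁻¹ elsewhere. The product exceeds 1 only on D
  -- × K, where the distance is at least t and the cost allows the value z.
  set f : (Fin n → ℝ) → ℝ := fun x => D.indicator (fun _ => z - 1) x + 1 with hf
  set g : (Fin n → ℝ) → ℝ := fun x => K.indicator (fun _ => 1 - z⁻¹) x + z⁻¹ with hg
  have hzi : z⁻¹ ≤ 1 := inv_le_one_of_one_le₀ hz1
  have hzi0 : 0 < z⁻¹ := by positivity
  have hfm : Measurable f := (measurable_const.indicator hD).add_const _
  have hgm : Measurable g := (measurable_const.indicator hK).add_const _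
  have hf0 : ∀ x, 0 ≤ f x := fun x => by
    simp only [hf, Set.indicator_apply]; split_ifs <;> linarith
  have hg0 : ∀ x, 0 ≤ g x := fun x => by
    simp only [hg, Set.indicator_apply]; split_ifs <;> linarith
  have hfz : ∀ x, f x ≤ z := fun x => by
    simp only [hf, Set.indicator_apply]; split_ifs <;> linarith
  have hgz : ∀ x, g x ≤ z := fun x => by
    simp only [hg, Set.indicator_apply]; split_ifs <;> linarith
  have key := pi_gaussianReal_property_tau hv z.toNNReal n 1 (fun x => ENNReal.ofReal (f x))
    (fun x => ENNReal.ofReal (g x)) hfm.ennreal_ofReal hgm.ennreal_ofReal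
    (fun x => ENNReal.ofReal_le_ofReal (hfz x)) (fun x => ENNReal.ofReal_le_ofReal (hgz x))
    (fun x y => by
      rw [ENNReal.coe_one, one_mul, ← ENNReal.ofReal_mul (hf0 x)]
      refine ENNReal.ofReal_le_ofReal ?_
      have hexp1 : 1 ≤ Real.exp ((∑ i, (x i - y i) ^ 2) / (4 * v)) :=
        Real.one_le_exp (by positivity)
      by_cases hx : x ∈ D <;> by_cases hy : y ∈ K
      · simp only [hf, hg, hx, hy, Set.indicator_of_mem]
        rw [sub_add_cancel, sub_add_cancel, mul_one, hz, Real.exp_le_exp]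
        exact div_le_div_of_nonneg_right (hdist x hx y hy) (by positivity)
      · simp only [hf, hg, hx, hy, Set.indicator_of_mem, Set.indicator_of_notMem,
          not_false_eq_true]
        rw [sub_add_cancel, zero_add, mul_inv_cancel₀ (by positivity)]
        exact hexp1
      · simp only [hf, hg, hx, hy, Set.indicator_of_mem, Set.indicator_of_notMem,
          not_false_eq_true]
        linarith
      · simp only [hf, hg, hx, hy, Set.indicator_of_notMem, not_false_eq_true]
        linarith)
  have hint : ∀ (k : (Fin n → ℝ) → ℝ) (S : Set (Fin n → ℝ)) (r q : ℝ), MeasurableSet S →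
      (k = fun x => S.indicator (fun _ => r) x + q) → (∀ x, 0 ≤ k x) →
      ∫⁻ x, ENNReal.ofReal (k x) ∂ν = ENNReal.ofReal (ν.real S * r + q) := by
    intro k S r q hS hk hk0
    have hi : Integrable (S.indicator fun _ => r) ν := (integrable_const r).indicator hS
    have hki : Integrable k ν := hk ▸ hi.add (integrable_const q)
    rw [← ofReal_integral_eq_lintegral_ofReal hki (.of_forall hk0), hk,
      integral_add hi (integrable_const q), integral_indicator_const _ hS]
    simp
  rw [hint f D _ _ hD rfl hf0, hint g K _ _ hK rfl hg0] at key
  set p := ν.real K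
  set q := ν.real D
  have hq0 : 0 ≤ q := measureReal_nonneg
  have hA : 0 ≤ q * (z - 1) + 1 := by
    have := mul_nonneg hq0 (sub_nonneg.2 hz1); linarith
  rw [← ENNReal.ofReal_mul hA, ENNReal.coe_one, ENNReal.ofReal_le_one] at key
  set w := Real.exp (t ^ 2 / (8 * v)) with hw
  have hw1 : 1 < w := Real.one_lt_exp_iff.2 (by positivity)
  have hzw : z = w ^ 2 := by
    rw [hz, hw, ← Real.exp_nat_mul]
    congr 1
    push_cast
    field_simp
    ring
  rw [Real.exp_neg, ← hw]
  have h1 : (q * (z - 1) + 1) * ((1 + z⁻¹) / 2) ≤ 1 := by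
    refine le_trans (mul_le_mul_of_nonneg_left ?_ hA) key
    nlinarith
  have h2 : (q * (z - 1) + 1) * (z + 1) ≤ 2 * z := by
    have : (q * (z - 1) + 1) * (z + 1) = 2 * z * ((q * (z - 1) + 1) * ((1 + z⁻¹) / 2)) := by
      field_simp
    rw [this]
    nlinarith
  have hz2 : 0 < z - 1 := by nlinarith
  have h3 : q * (z + 1) ≤ 1 := by
    have : (z - 1) * (q * (z + 1)) ≤ (z - 1) * 1 := by linarith
    exact le_of_mul_le_mul_left this hz2
  -- From q ≤ 1/(1 + w²) and 1 + w² ≥ 2w; the prefactor 1/2 arises here and later turns δ₀ into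
  -- δ₀/2.
  rw [← one_div, div_mul_div_comm, le_div_iff₀ (by positivity)]
  nlinarith [sq_nonneg (w - 1)]

/-! ### Sums of largest values and sorted norms -/

/-- The permutation that puts the values of `f` into decreasing order. -/
def descPerm {k : ℕ} (f : Fin k → ℝ) : Equiv.Perm (Fin k) :=
  Fin.revPerm.trans (Tuple.sort f)

lemma sortedDesc_eq_comp_descPerm {k : ℕ} (f : Fin k → ℝ) (i : Fin k) :
    sortedDesc f i = f (descPerm f i) := rfl

lemma sortedDesc_antitone {k : ℕ} (f : Fin k → ℝ) : Antitone (sortedDesc f) :=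
  fun _ _ h => Tuple.monotone_sort f (Fin.rev_le_rev.2 h)

lemma sum_sortedDesc {k : ℕ} (f : Fin k → ℝ) (φ : ℝ → ℝ) :
    ∑ i, φ (sortedDesc f i) = ∑ i, φ (f i) :=
  Equiv.sum_comp (descPerm f) fun i => φ (f i)

/-- The sum of the `r` largest values of `f`. -/
def topSum {k : ℕ} (f : Fin k → ℝ) (r : ℕ) : ℝ :=
  ∑ i with (i : Fin k).val < r, sortedDesc f i

lemma card_filter_val_lt {k r : ℕ} (h : r ≤ k) :
    (Finset.univ.filter fun i : Fin k => i.val < r).card = r := by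
  rw [Fin.card_filter_val_lt]
  exact min_eq_right h

/-- Exchange argument: members of B outside the first r indices have values at most g(r), the
indices they displace have values at least g(r), and there are no fewer of the latter. -/
lemma sum_le_sum_filter_of_antitone {k : ℕ} {g : Fin k → ℝ} (hg : Antitone g)
    (hg0 : ∀ i, 0 ≤ g i) {r : ℕ} {B : Finset (Fin k)} (hB : B.card ≤ r) :
    ∑ i ∈ B, g i ≤ ∑ i with (i : Fin k).val < r, g i := by
  rcases le_or_gt k r with hk | hk
  · refine Finset.sum_le_sum_of_subset_of_nonneg (fun i _ => ?_) fun i _ _ => hg0 i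
    simpa using lt_of_lt_of_le i.2 hk
  set I := Finset.univ.filter fun i : Fin k => i.val < r with hI
  have hcard : B.card ≤ I.card := by rw [card_filter_val_lt hk.le]; exact hB
  rw [← Finset.sum_inter_add_sum_sdiff B I, ← Finset.sum_inter_add_sum_sdiff I B,
    Finset.inter_comm I B]
  have h1 : ∑ i ∈ B \ I, g i ≤ (B \ I).card • g ⟨r, hk⟩ := by
    refine Finset.sum_le_card_nsmul _ _ _ fun i hi => hg ?_
    simp only [hI, Finset.mem_sdiff, Finset.mem_filter, Finset.mem_univ, true_and, not_lt] at hi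
    exact hi.2
  have h2 : (I \ B).card • g ⟨r, hk⟩ ≤ ∑ i ∈ I \ B, g i := by
    refine Finset.card_nsmul_le_sum _ _ _ fun i hi => hg ?_
    simp only [hI, Finset.mem_sdiff, Finset.mem_filter, Finset.mem_univ, true_and] at hi
    exact hi.1.le
  have h3 : (B \ I).card • g ⟨r, hk⟩ ≤ (I \ B).card • g ⟨r, hk⟩ :=
    nsmul_le_nsmul_left (hg0 _) (Finset.card_sdiff_le_card_sdiff_iff.2 hcard)
  linarith

lemma sum_le_topSum {k : ℕ} {f : Fin k → ℝ} (hf : ∀ i, 0 ≤ f i) {r : ℕ} {A : Finset (Fin k)}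
    (hA : A.card ≤ r) : ∑ i ∈ A, f i ≤ topSum f r := by
  have := sum_le_sum_filter_of_antitone (sortedDesc_antitone f) (fun i => hf _) (r := r)
    (B := A.map (descPerm f).symm.toEmbedding) (by simpa using hA)
  simpa [sortedDesc_eq_comp_descPerm, topSum] using this

lemma exists_sum_eq_topSum {k : ℕ} (f : Fin k → ℝ) (r : ℕ) :
    ∃ A : Finset (Fin k), A.card = min k r ∧ ∑ i ∈ A, f i = topSum f r := by
  refine ⟨(Finset.univ.filter fun i : Fin k => i.val < r).map (descPerm f).toEmbedding, ?_, ?_⟩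
  · rw [Finset.card_map, Fin.card_filter_val_lt]
  · simp [topSum, sortedDesc_eq_comp_descPerm]

lemma topSum_le_add {k : ℕ} {f g h : Fin k → ℝ} (hg : ∀ i, 0 ≤ g i) (hh : ∀ i, 0 ≤ h i)
    {a b : ℝ} (ha : 0 ≤ a) (hb : 0 ≤ b) (hf : ∀ i, f i ≤ a * g i + b * h i) (r : ℕ) :
    topSum f r ≤ a * topSum g r + b * topSum h r := by
  obtain ⟨A, hA, hAf⟩ := exists_sum_eq_topSum f r
  have hAr : A.card ≤ r := hA.trans_le (min_le_right _ _)
  calc topSum f r = ∑ i ∈ A, f i := hAf.symm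
    _ ≤ ∑ i ∈ A, (a * g i + b * h i) := Finset.sum_le_sum fun i _ => hf i
    _ = a * ∑ i ∈ A, g i + b * ∑ i ∈ A, h i := by
        rw [Finset.sum_add_distrib, Finset.mul_sum, Finset.mul_sum]
    _ ≤ _ := by
        gcongr
        · exact sum_le_topSum hg hAr
        · exact sum_le_topSum hh hAr

/-- Used with f, g, h the sizes of β, u, β + u and S the support of β. For r ≥ q, split a top-r set
of g into B, which avoids S, and at most q further indices. On B, g is dominated by h, and S ∪ B
still has at most r elements; g on S and g on the further indices each cost at most the top-q sum of
g. -/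
lemma topSum_add_topSum_le {k : ℕ} {f g h : Fin k → ℝ} (hf : ∀ i, 0 ≤ f i)
    (hg : ∀ i, 0 ≤ g i) (hh : ∀ i, 0 ≤ h i) (hfgh : ∀ i, f i ≤ h i + g i)
    {S : Finset (Fin k)} {q : ℕ} (hS : S.card ≤ q) (hfS : ∀ i, i ∉ S → f i = 0)
    (hgS : ∀ i, i ∉ S → g i ≤ h i) (r : ℕ) :
    topSum f r + topSum g r ≤ topSum h r + 2 * topSum g (min r q) := by
  rcases le_total r q with hrq | hrq
  · rw [min_eq_left hrq]
    have := topSum_le_add hh hg zero_le_one zero_le_one (fun i => by simpa using hfgh i) r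
    linarith
  rw [min_eq_right hrq]
  obtain ⟨A, hA, hAf⟩ := exists_sum_eq_topSum f r
  obtain ⟨R, hR, hRg⟩ := exists_sum_eq_topSum g r
  have hfA : ∑ i ∈ A, f i ≤ ∑ i ∈ S, f i := by
    rw [← Finset.sum_inter_add_sum_sdiff A S]
    have h0 : ∑ i ∈ A \ S, f i = 0 :=
      Finset.sum_eq_zero fun i hi => hfS i (Finset.mem_sdiff.1 hi).2
    rw [h0, add_zero]
    exact Finset.sum_le_sum_of_subset_of_nonneg Finset.inter_subset_right fun i _ _ => hf i
  obtain ⟨B, hBR, hB⟩ : ∃ B ⊆ R \ S, B.card = R.card - q :=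
    Finset.exists_subset_card_eq (by
      have := Finset.le_card_sdiff S R
      omega)
  have hBR' : B ⊆ R := hBR.trans Finset.sdiff_subset
  have hBS : Disjoint S B :=
    Finset.disjoint_left.2 fun i hi hiB => (Finset.mem_sdiff.1 (hBR hiB)).2 hi
  have hRr : R.card ≤ r := hR.trans_le (min_le_right _ _)
  have h1 : ∑ i ∈ S ∪ B, h i ≤ topSum h r := by
    refine sum_le_topSum hh ?_
    rw [Finset.card_union_of_disjoint hBS]
    omega
  rw [Finset.sum_union hBS] at h1
  have h2 : ∑ i ∈ B, g i ≤ ∑ i ∈ B, h i :=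
    Finset.sum_le_sum fun i hi => hgS i (Finset.mem_sdiff.1 (hBR hi)).2
  have h3 : ∑ i ∈ S, f i ≤ ∑ i ∈ S, h i + ∑ i ∈ S, g i := by
    rw [← Finset.sum_add_distrib]
    exact Finset.sum_le_sum fun i _ => hfgh i
  have h4 : ∑ i ∈ S, g i ≤ topSum g q := sum_le_topSum hg hS
  have h5 : ∑ i ∈ R \ B, g i ≤ topSum g q := by
    refine sum_le_topSum hg ?_
    rw [Finset.card_sdiff_of_subset hBR']
    omega
  have h6 := Finset.sum_sdiff (f := g) hBR'
  linarith

/-- Abel summation: the induction shows that the weighted sum dominates the last weight times the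
last partial sum. -/
lemma sum_mul_nonneg_of_partial_sums {w c : ℕ → ℝ} (hw : ∀ i, w (i + 1) ≤ w i)
    (hw0 : ∀ i, 0 ≤ w i) (hc : ∀ r, 0 ≤ ∑ i ∈ Finset.range r, c i) (n : ℕ) :
    0 ≤ ∑ i ∈ Finset.range n, w i * c i := by
  have key : ∀ n, w n * ∑ i ∈ Finset.range (n + 1), c i
      ≤ ∑ i ∈ Finset.range (n + 1), w i * c i := by
    intro n
    induction n with
    | zero => simp
    | succ n ih =>
      rw [Finset.sum_range_succ (n := n + 1), Finset.sum_range_succ (n := n + 1), mul_add]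
      have := mul_le_mul_of_nonneg_right (hw n) (hc (n + 1))
      linarith
  rcases n with _ | n
  · simp
  · exact (mul_nonneg (hw0 n) (hc _)).trans (key n)

lemma sum_filter_val_lt_eq {k : ℕ} (c : Fin k → ℝ) (r : ℕ) :
    ∑ i with (i : Fin k).val < r, c i
      = ∑ i ∈ Finset.range r, if h : i < k then c ⟨i, h⟩ else 0 := by
  rw [Finset.sum_filter]
  have h1 : ∀ i : Fin k, (if i.val < r then c i else 0) =
      (fun j : ℕ => if j < r then (if h : j < k then c ⟨j, h⟩ else 0) else 0) i.val := by
    intro i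
    simp
  simp_rw [h1]
  rw [Fin.sum_univ_eq_sum_range
    (fun j : ℕ => if j < r then (if h : j < k then c ⟨j, h⟩ else 0) else 0) k,
    ← Finset.sum_filter]
  refine Finset.sum_congr_of_eq_on_inter ?_ ?_ ?_
  · intro i hi hi'
    simp at hi hi'
    omega
  · intro i hi hi'
    simp only [Finset.mem_filter, Finset.mem_range, not_and] at hi hi'
    exact dif_neg fun hk => hi' hk hi
  · intro i _ _
    rfl

/-- Summation by parts: domination of partial sums passes to sums with decreasing weights. -/
lemma sum_mul_le_sum_mul_of_partial_sums {k : ℕ} {w : ℕ → ℝ} (hw : ∀ i, w (i + 1) ≤ w i)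
    (hw0 : ∀ i, 0 ≤ w i) {a b : Fin k → ℝ}
    (h : ∀ r : ℕ, ∑ i with (i : Fin k).val < r, a i ≤ ∑ i with (i : Fin k).val < r, b i) :
    ∑ i : Fin k, w i * a i ≤ ∑ i : Fin k, w i * b i := by
  have key := sum_mul_nonneg_of_partial_sums (c := fun i => if h : i < k then b ⟨i, h⟩ - a ⟨i, h⟩
    else 0) hw hw0 (fun r => by
      rw [← sum_filter_val_lt_eq (fun i => b i - a i) r, Finset.sum_sub_distrib]
      exact sub_nonneg.2 (h r)) k
  rw [← Fin.sum_univ_eq_sum_range] at key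
  simp only [Fin.is_lt, dif_pos, Fin.eta, mul_sub, Finset.sum_sub_distrib] at key
  linarith

/-- The sorted sum `∑ᵢ wᵢ f₍ᵢ₎`. -/
def sortedSum {k : ℕ} (w : ℕ → ℝ) (f : Fin k → ℝ) : ℝ :=
  ∑ i : Fin k, w (i + 1) * sortedDesc f i

/-- The first `q` terms of the sorted sum. -/
def sortedHead {k : ℕ} (w : ℕ → ℝ) (q : ℕ) (f : Fin k → ℝ) : ℝ :=
  ∑ i : Fin k, w (i + 1) * if (i : ℕ) < q then sortedDesc f i else 0

/-- Abel summation reduces sublinearity to that of each top-r sum, a maximum of sums over index sets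
of at most r elements. -/
lemma sortedSum_le_add {k : ℕ} {w : ℕ → ℝ} (hw : ∀ i, w (i + 2) ≤ w (i + 1))
    (hw0 : ∀ i, 0 ≤ w (i + 1)) {f g h : Fin k → ℝ} (hg : ∀ i, 0 ≤ g i) (hh : ∀ i, 0 ≤ h i)
    {a b : ℝ} (ha : 0 ≤ a) (hb : 0 ≤ b) (hf : ∀ i, f i ≤ a * g i + b * h i) :
    sortedSum w f ≤ a * sortedSum w g + b * sortedSum w h := by
  have := sum_mul_le_sum_mul_of_partial_sums (w := fun i => w (i + 1)) hw hw0
    (a := sortedDesc f) (b := fun i => a * sortedDesc g i + b * sortedDesc h i) fun r => by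
      rw [Finset.sum_add_distrib, ← Finset.mul_sum, ← Finset.mul_sum]
      exact topSum_le_add hg hh ha hb hf r
  refine this.trans (le_of_eq ?_)
  simp only [sortedSum, Finset.mul_sum, ← Finset.sum_add_distrib]
  exact Finset.sum_congr rfl fun i _ => by ring

lemma sortedSum_add_sortedSum_le {k : ℕ} {w : ℕ → ℝ} (hw : ∀ i, w (i + 2) ≤ w (i + 1))
    (hw0 : ∀ i, 0 ≤ w (i + 1)) {f g h : Fin k → ℝ} (hf : ∀ i, 0 ≤ f i)
    (hg : ∀ i, 0 ≤ g i) (hh : ∀ i, 0 ≤ h i) (hfgh : ∀ i, f i ≤ h i + g i)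
    {S : Finset (Fin k)} {q : ℕ} (hS : S.card ≤ q) (hfS : ∀ i, i ∉ S → f i = 0)
    (hgS : ∀ i, i ∉ S → g i ≤ h i) :
    sortedSum w f + sortedSum w g ≤ sortedSum w h + 2 * sortedHead w q g := by
  have := sum_mul_le_sum_mul_of_partial_sums (w := fun i => w (i + 1)) hw hw0
    (a := fun i => sortedDesc f i + sortedDesc g i)
    (b := fun i => sortedDesc h i + 2 * if (i : ℕ) < q then sortedDesc g i else 0) fun r => by
      rw [Finset.sum_add_distrib, Finset.sum_add_distrib, ← Finset.mul_sum, ← Finset.sum_filter,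
        Finset.filter_filter]
      simp_rw [← lt_min_iff]
      exact topSum_add_topSum_le hf hg hh hfgh hS hfS hgS r
  simp only [sortedSum, sortedHead, Finset.mul_sum, ← Finset.sum_add_distrib]
  refine le_trans (le_of_eq (Finset.sum_congr rfl fun i _ => ?_)) (this.trans
    (le_of_eq (Finset.sum_congr rfl fun i _ => ?_))) <;> ring

lemma sortedHead_le {k : ℕ} (w : ℕ → ℝ) (q : ℕ) (f : Fin k → ℝ) :
    sortedHead w q f
      ≤ Real.sqrt (∑ i ∈ Finset.Icc 1 q, w i ^ 2) * Real.sqrt (∑ i, f i ^ 2) := by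
  have e : sortedHead w q f
      = ∑ i : Fin k, (if (i : ℕ) < q then w (i + 1) else 0) * sortedDesc f i := by
    refine Finset.sum_congr rfl fun i _ => ?_
    split_ifs <;> simp
  rw [e]
  refine (Real.sum_mul_le_sqrt_mul_sqrt _ _ _).trans ?_
  rw [sum_sortedDesc f fun x => x ^ 2]
  refine mul_le_mul_of_nonneg_right (Real.sqrt_le_sqrt ?_) (Real.sqrt_nonneg _)
  rw [Fin.sum_univ_eq_sum_range (fun i : ℕ => (if i < q then w (i + 1) else 0) ^ 2) k]
  have e2 : ∑ i ∈ Finset.Icc 1 q, w i ^ 2 = ∑ i ∈ Finset.range q, w (i + 1) ^ 2 := by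
    rw [Finset.range_eq_Ico, Finset.sum_Ico_add' (fun i => w i ^ 2) 0 q 1]
    rfl
  rw [e2]
  have e3 : ∀ i : ℕ, (if i < q then w (i + 1) else 0) ^ 2
      = if i < q then w (i + 1) ^ 2 else 0 := by
    intro i; split_ifs <;> simp
  simp_rw [e3]
  rw [← Finset.sum_filter]
  -- Only an inclusion of index sets, since q may exceed k.
  refine Finset.sum_le_sum_of_subset_of_nonneg (fun i hi => ?_) fun i _ _ => sq_nonneg _
  simp only [Finset.mem_filter, Finset.mem_range] at hi ⊢
  exact hi.2

/-! ### The weights -/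

lemma lam_nonneg {σ : ℝ} (hσ : 0 ≤ σ) (d m s₀ j : ℕ) : 0 ≤ lam σ d m s₀ j :=
  mul_nonneg hσ (Real.sqrt_nonneg _)

lemma lam_le_lam {σ : ℝ} (hσ : 0 ≤ σ) (d m s₀ : ℕ) {i j : ℕ} (hi : 1 ≤ i) (hij : i ≤ j) :
    lam σ d m s₀ j ≤ lam σ d m s₀ i := by
  refine mul_le_mul_of_nonneg_left (Real.sqrt_le_sqrt ?_) hσ
  rcases Nat.eq_zero_or_pos m with rfl | hm
  · simp
  have hi' : (0 : ℝ) < i := by exact_mod_cast hi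
  have hj' : (0 : ℝ) < j := by exact_mod_cast hi.trans hij
  have hm' : (0 : ℝ) < m := by exact_mod_cast hm
  gcongr

lemma lamTilde_nonneg {σ : ℝ} (hσ : 0 ≤ σ) (d m s₀ i : ℕ) : 0 ≤ lamTilde σ d m s₀ i := by
  unfold lamTilde
  split_ifs <;> exact lam_nonneg hσ _ _ _ _

lemma lamTilde_succ_le {σ : ℝ} (hσ : 0 ≤ σ) (d m : ℕ) {s₀ : ℕ} (hs₀ : 1 ≤ s₀) (i : ℕ) :
    lamTilde σ d m s₀ (i + 2) ≤ lamTilde σ d m s₀ (i + 1) := by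
  have h1 : 1 ≤ (i + 1) ⌈/⌉ s₀ := by
    rw [Nat.ceilDiv_eq_add_pred_div, Nat.le_div_iff_mul_le hs₀]
    omega
  unfold lamTilde
  split_ifs with h2 h3 h3
  · refine lam_le_lam hσ _ _ _ h1 ?_
    rw [Nat.ceilDiv_eq_add_pred_div, Nat.ceilDiv_eq_add_pred_div]
    exact Nat.div_le_div_right (by omega)
  · omega
  · refine lam_le_lam hσ _ _ _ h1 ?_
    exact (ceilDiv_le_iff_le_mul hs₀).2 h3
  · exact le_rfl

/-- The extended weights repeat each λ_j on a block of s₀ consecutive indices. Thus one constant Λ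
controls the heads of both halves of the penalty. -/
lemma sum_lamTilde_sq {σ : ℝ} {d m s₀ : ℕ} (hs₀ : 1 ≤ s₀) {s : ℕ} (hs : s ≤ m) :
    ∑ i ∈ Finset.Icc 1 (s * s₀), lamTilde σ d m s₀ i ^ 2
      = s₀ * ∑ j ∈ Finset.Icc 1 s, lam σ d m s₀ j ^ 2 := by
  have e : ∀ (q : ℕ) (w : ℕ → ℝ),
      ∑ i ∈ Finset.Icc 1 q, w i = ∑ i ∈ Finset.range q, w (i + 1) := by
    intro q w
    rw [Finset.range_eq_Ico, Finset.sum_Ico_add' w 0 q 1]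
    rfl
  rw [e, e]
  induction s with
  | zero => simp
  | succ s ih =>
    rw [Nat.succ_mul, Finset.sum_range_add, ih (by omega), Finset.sum_range_succ, mul_add]
    congr 1
    rw [Finset.sum_congr rfl (g := fun _ => lam σ d m s₀ (s + 1) ^ 2)]
    · simp
    intro x hx
    have hx : x < s₀ := Finset.mem_range.1 hx
    have h1 : s * s₀ + x + 1 ≤ s₀ * m := by
      have : (s + 1) * s₀ ≤ m * s₀ := Nat.mul_le_mul_right _ hs
      rw [Nat.mul_comm s₀ m]
      nlinarith
    have h2 : (s * s₀ + x + 1) ⌈/⌉ s₀ = s + 1 := by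
      rw [Nat.ceilDiv_eq_add_pred_div]
      have : s * s₀ + x + 1 + s₀ - 1 = x + s₀ * (s + 1) := by
        rw [Nat.mul_comm s₀, Nat.succ_mul]; omega
      rw [this, Nat.add_mul_div_left _ _ hs₀, Nat.div_eq_of_lt hx, zero_add]
    simp only [lamTilde, h1, if_true, h2]

/-- The left side is s log s − log s!, and sˢ/s! ≤ eˢ is one term of the exponential series. -/
lemma sum_log_sub_log_le {s : ℕ} (hs : 1 ≤ s) :
    ∑ j ∈ Finset.Icc 1 s, (Real.log s - Real.log j) ≤ s := by
  have h1 : ∑ j ∈ Finset.Icc 1 s, Real.log (j : ℝ) = Real.log (s.factorial : ℝ) := by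
    clear hs
    induction s with
    | zero => simp
    | succ s ih =>
      rw [Finset.sum_Icc_succ_top (by omega), ih, Nat.factorial_succ, Nat.cast_mul,
        Real.log_mul (by positivity) (by positivity), add_comm]
  have hs' : (0 : ℝ) < s := by exact_mod_cast hs
  have hf : (0 : ℝ) < s.factorial := by exact_mod_cast s.factorial_pos
  have h2 := Real.log_le_log (by positivity)
    (Real.pow_div_factorial_le_exp (s : ℝ) hs'.le s)
  rw [Real.log_exp, Real.log_div (by positivity) hf.ne', Real.log_pow] at h2
  rw [Finset.sum_sub_distrib, h1]
  simpa using h2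

lemma one_le_log_group_size {d s₀ : ℕ} (hs₀ : 1 ≤ s₀) (hd : s₀ ≤ d) :
    1 ≤ Real.log (2 * Real.exp 1 * d / s₀) := by
  have hs₀' : (0 : ℝ) < s₀ := by exact_mod_cast hs₀
  have hd' : (s₀ : ℝ) ≤ d := by exact_mod_cast hd
  have hd0 : (0 : ℝ) < d := hs₀'.trans_le hd'
  rw [Real.le_log_iff_exp_le (by positivity), le_div_iff₀ hs₀']
  nlinarith [Real.exp_pos 1]

lemma two_le_log_group_number {m j : ℕ} (hj : 1 ≤ j) (hjm : j ≤ m) :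
    2 ≤ Real.log (4 * Real.exp 1 * m / j) := by
  have hj' : (0 : ℝ) < j := by exact_mod_cast hj
  have hm' : (j : ℝ) ≤ m := by exact_mod_cast hjm
  have hm0 : (0 : ℝ) < m := hj'.trans_le hm'
  rw [Real.le_log_iff_exp_le (by positivity), le_div_iff₀ hj',
    show (2 : ℝ) = 1 + 1 by norm_num, Real.exp_add]
  have h1 : Real.exp 1 ≤ 4 := by linarith [Real.exp_one_lt_d9]
  have h2 : Real.exp 1 * Real.exp 1 ≤ 4 * Real.exp 1 :=
    mul_le_mul_of_nonneg_right h1 (Real.exp_pos _).le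
  exact mul_le_mul h2 hm' hj'.le (by positivity)

lemma lam_sq {σ : ℝ} {d m s₀ j : ℕ} (hs₀ : 1 ≤ s₀) (hd : s₀ ≤ d) (hj : 1 ≤ j) (hjm : j ≤ m) :
    lam σ d m s₀ j ^ 2 = σ ^ 2 * (Real.log (2 * Real.exp 1 * d / s₀)
      + 2 / s₀ * Real.log (4 * Real.exp 1 * m / j)) := by
  have h1 := one_le_log_group_size hs₀ hd
  have h2 := two_le_log_group_number hj hjm
  rw [lam, mul_pow, Real.sq_sqrt]
  positivity

lemma lam_pos {σ : ℝ} (hσ : 0 < σ) {d m s₀ j : ℕ} (hs₀ : 1 ≤ s₀) (hd : s₀ ≤ d) (hj : 1 ≤ j)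
    (hjm : j ≤ m) : 0 < lam σ d m s₀ j := by
  have h1 := one_le_log_group_size hs₀ hd
  have h2 := two_le_log_group_number hj hjm
  refine mul_pos hσ (Real.sqrt_pos.2 ?_)
  positivity

/-- λ_j² exceeds λ_s² by σ²(2/s₀)(log s − log j), and these logarithms sum to at most s. The factor
25/16 = (5/4)² is chosen to have a rational root. -/
lemma sum_lam_sq_le {σ : ℝ} {d m s₀ s : ℕ} (hs₀ : 1 ≤ s₀) (hd : s₀ ≤ d) (hs : 1 ≤ s)
    (hsm : s ≤ m) :
    ∑ j ∈ Finset.Icc 1 s, lam σ d m s₀ j ^ 2 ≤ 25 / 16 * (s * lam σ d m s₀ s ^ 2) := by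
  have hA := one_le_log_group_size hs₀ hd
  have hB := two_le_log_group_number hs hsm
  have hs' : (0 : ℝ) < s := by exact_mod_cast hs
  have hm' : (0 : ℝ) < m := by exact_mod_cast hs.trans hsm
  have hs₀' : (0 : ℝ) < s₀ := by exact_mod_cast hs₀
  rw [lam_sq hs₀ hd hs hsm]
  set A := Real.log (2 * Real.exp 1 * d / s₀)
  set B := Real.log (4 * Real.exp 1 * m / s) with hBdef
  have e : ∀ j ∈ Finset.Icc 1 s, lam σ d m s₀ j ^ 2
      = σ ^ 2 * (A + 2 / s₀ * B) + σ ^ 2 * (2 / s₀) * (Real.log s - Real.log j) := by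
    intro j hj
    obtain ⟨hj1, hjs⟩ := Finset.mem_Icc.1 hj
    have hj' : (0 : ℝ) < j := by exact_mod_cast hj1
    rw [lam_sq hs₀ hd hj1 (hjs.trans hsm), hBdef, Real.log_div (by positivity) hj'.ne',
      Real.log_div (by positivity) hs'.ne']
    ring
  rw [Finset.sum_congr rfl e, Finset.sum_add_distrib, ← Finset.mul_sum (Finset.Icc 1 s)
    (fun j : ℕ => Real.log s - Real.log j)]
  have h1 := mul_le_mul_of_nonneg_left (sum_log_sub_log_le hs)
    (show 0 ≤ σ ^ 2 * (2 / s₀) by positivity)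
  simp only [Finset.sum_const, Nat.card_Icc, Nat.add_sub_cancel, nsmul_eq_mul]
  -- Since B ≥ 2, the term (9/16)(2/s₀)B alone suffices; 9/16 is 25/16 − 1.
  have h2 : 2 / (s₀ : ℝ) ≤ 9 / 16 * (A + 2 / s₀ * B) := by
    have : 0 < 2 / (s₀ : ℝ) := by positivity
    nlinarith
  have h3 := mul_le_mul_of_nonneg_left h2 (show 0 ≤ s * σ ^ 2 by positivity)
  linarith

/-- The head of the weights has Euclidean norm comparable to that of the constant weight
`λ_s`. -/
lemma sqrt_sum_lamTilde_sq_bounds {σ : ℝ} (hσ : 0 < σ) {d m s₀ s : ℕ} (hs₀ : 1 ≤ s₀)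
    (hd : s₀ ≤ d) (hs : 1 ≤ s) (hsm : s ≤ m) :
    Real.sqrt (s * s₀) * lam σ d m s₀ s
        ≤ Real.sqrt (∑ i ∈ Finset.Icc 1 (s * s₀), lamTilde σ d m s₀ i ^ 2) ∧
      Real.sqrt (∑ i ∈ Finset.Icc 1 (s * s₀), lamTilde σ d m s₀ i ^ 2)
        ≤ 5 / 4 * (Real.sqrt (s * s₀) * lam σ d m s₀ s) := by
  have hl := lam_nonneg hσ.le d m s₀ s
  have hsq : (Real.sqrt (s * s₀) * lam σ d m s₀ s) ^ 2 = s₀ * (s * lam σ d m s₀ s ^ 2) := by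
    rw [mul_pow, Real.sq_sqrt (by positivity)]; ring
  rw [sum_lamTilde_sq hs₀ hsm]
  constructor
  · refine Real.le_sqrt_of_sq_le ?_
    rw [hsq]
    refine mul_le_mul_of_nonneg_left ?_ (Nat.cast_nonneg _)
    have := Finset.card_nsmul_le_sum (Finset.Icc 1 s) (fun j => lam σ d m s₀ j ^ 2)
      (lam σ d m s₀ s ^ 2) fun j hj => by
        obtain ⟨hj1, hjs⟩ := Finset.mem_Icc.1 hj
        exact pow_le_pow_left₀ hl (lam_le_lam hσ.le _ _ _ hj1 hjs) 2
    simpa using this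
  · refine Real.sqrt_le_iff.2 ⟨by positivity, ?_⟩
    rw [mul_pow, hsq]
    have := mul_le_mul_of_nonneg_left (sum_lam_sq_le (σ := σ) hs₀ hd hs hsm)
      (Nat.cast_nonneg (α := ℝ) s₀)
    linarith

/-! ### The penalty, the basic inequality and the noise bound -/

section Estimator

variable {n p m : ℕ} {G : Fin m → Finset (Fin p)}

lemma groupNorm_eq_norm (G : Fin m → Finset (Fin p)) (β : EuclideanSpace ℝ (Fin p)) (j : Fin m) :
    groupNorm G β j = ‖(WithLp.toLp 2 fun i : G j => β i : EuclideanSpace ℝ (G j))‖ := by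
  rw [EuclideanSpace.norm_eq, groupNorm, ← Finset.sum_coe_sort (G j)]
  simp

lemma groupNorm_nonneg (β : EuclideanSpace ℝ (Fin p)) (j : Fin m) : 0 ≤ groupNorm G β j :=
  Real.sqrt_nonneg _

lemma groupNorm_combo_le {a b : ℝ} (ha : 0 ≤ a) (hb : 0 ≤ b) (β u : EuclideanSpace ℝ (Fin p))
    (j : Fin m) : groupNorm G (a • β + b • u) j ≤ a * groupNorm G β j + b * groupNorm G u j := by
  simp only [groupNorm_eq_norm]
  have : (WithLp.toLp 2 fun i : G j => (a • β + b • u) i : EuclideanSpace ℝ (G j))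
      = a • (WithLp.toLp 2 fun i : G j => β i : EuclideanSpace ℝ (G j))
        + b • (WithLp.toLp 2 fun i : G j => u i : EuclideanSpace ℝ (G j)) := by
    ext i; simp
  rw [this]
  refine (norm_add_le _ _).trans (le_of_eq ?_)
  rw [norm_smul, norm_smul, Real.norm_of_nonneg ha, Real.norm_of_nonneg hb]

lemma groupNorm_neg (u : EuclideanSpace ℝ (Fin p)) (j : Fin m) :
    groupNorm G (-u) j = groupNorm G u j := by
  simp [groupNorm]

lemma groupNorm_congr {β u : EuclideanSpace ℝ (Fin p)} {j : Fin m} (h : ∀ i ∈ G j, β i = u i) :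
    groupNorm G β j = groupNorm G u j := by
  rw [groupNorm, groupNorm, Finset.sum_congr rfl fun i hi => by rw [h i hi]]

lemma sum_groupNorm_sq_le (hG : ∀ j k, j ≠ k → Disjoint (G j) (G k))
    (u : EuclideanSpace ℝ (Fin p)) : ∑ j, groupNorm G u j ^ 2 ≤ ‖u‖ ^ 2 := by
  rw [EuclideanSpace.norm_eq, Real.sq_sqrt (by positivity)]
  simp only [groupNorm, Real.norm_eq_abs, sq_abs]
  simp_rw [Real.sq_sqrt (Finset.sum_nonneg fun i _ => sq_nonneg (u.ofLp i))]
  rw [← Finset.sum_biUnion fun j _ k _ hjk => hG j k hjk]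
  exact Finset.sum_le_sum_of_subset_of_nonneg (Finset.subset_univ _) fun i _ _ => sq_nonneg _

section StarNorm

variable {σ : ℝ} {d s₀ : ℕ}

lemma starNorm_eq (G : Fin m → Finset (Fin p)) (σ : ℝ) (d s₀ : ℕ)
    (β : EuclideanSpace ℝ (Fin p)) :
    starNorm G σ d s₀ β = sortedSum (lamTilde σ d m s₀) (fun l => |β l|)
      + Real.sqrt s₀ * sortedSum (lam σ d m s₀) (groupNorm G β) := rfl

lemma envelope_eq (n : ℕ) (G : Fin m → Finset (Fin p)) (σ : ℝ) (d s₀ : ℕ)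
    (u : EuclideanSpace ℝ (Fin p)) :
    envelope n G σ d s₀ u = 1 / Real.sqrt n * starNorm G σ d s₀ u := by
  rw [envelope, starNorm, sortedL1, sortedGroup, Finset.mul_sum, add_comm]
  congr 2
  · exact Finset.sum_congr rfl fun i _ => mul_comm _ _
  · exact Finset.sum_congr rfl fun i _ => by ring

lemma sortedSum_nonneg {k : ℕ} {w : ℕ → ℝ} (hw : ∀ i, 0 ≤ w i) {f : Fin k → ℝ}
    (hf : ∀ i, 0 ≤ f i) : 0 ≤ sortedSum w f :=
  Finset.sum_nonneg fun _ _ => mul_nonneg (hw _) (hf _)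

lemma sortedHead_le_sortedSum {k : ℕ} {w : ℕ → ℝ} (hw : ∀ i, 0 ≤ w i) {f : Fin k → ℝ}
    (hf : ∀ i, 0 ≤ f i) (q : ℕ) : sortedHead w q f ≤ sortedSum w f := by
  refine Finset.sum_le_sum fun i _ => mul_le_mul_of_nonneg_left ?_ (hw _)
  split_ifs
  · exact le_rfl
  · exact hf _

lemma starNorm_nonneg (hσ : 0 ≤ σ) (β : EuclideanSpace ℝ (Fin p)) :
    0 ≤ starNorm G σ d s₀ β := by
  rw [starNorm_eq]
  exact add_nonneg (sortedSum_nonneg (lamTilde_nonneg hσ _ _ _) fun _ => abs_nonneg _)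
    (mul_nonneg (Real.sqrt_nonneg _)
      (sortedSum_nonneg (lam_nonneg hσ _ _ _) (groupNorm_nonneg _)))

lemma starNorm_combo_le (hσ : 0 ≤ σ) (hs₀ : 1 ≤ s₀) {a b : ℝ} (ha : 0 ≤ a) (hb : 0 ≤ b)
    (β u : EuclideanSpace ℝ (Fin p)) :
    starNorm G σ d s₀ (a • β + b • u) ≤ a * starNorm G σ d s₀ β + b * starNorm G σ d s₀ u := by
  simp only [starNorm_eq]
  have h1 := sortedSum_le_add (lamTilde_succ_le hσ d m hs₀) (fun _ => lamTilde_nonneg hσ _ _ _ _)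
    (f := fun l => |(a • β + b • u) l|) (g := fun l => |β l|) (h := fun l => |u l|)
    (fun _ => abs_nonneg _) (fun _ => abs_nonneg _) ha hb (fun i => by
      simp only [PiLp.add_apply, PiLp.smul_apply, smul_eq_mul]
      refine (abs_add_le _ _).trans (le_of_eq ?_)
      rw [abs_mul, abs_mul, abs_of_nonneg ha, abs_of_nonneg hb])
  have h2 := sortedSum_le_add (w := lam σ d m s₀)
    (fun i => lam_le_lam hσ d m s₀ (Nat.le_add_left 1 i) (Nat.le_succ _))
    (fun _ => lam_nonneg hσ _ _ _ _)
    (groupNorm_nonneg (G := G) β) (groupNorm_nonneg u) ha hb (groupNorm_combo_le ha hb β u)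
  have h3 := mul_le_mul_of_nonneg_left h2 (Real.sqrt_nonneg (s₀ : ℝ))
  linarith

lemma starNorm_smul_le (hσ : 0 ≤ σ) (hs₀ : 1 ≤ s₀) {a : ℝ} (ha : 0 ≤ a)
    (β : EuclideanSpace ℝ (Fin p)) :
    starNorm G σ d s₀ (a • β) ≤ a * starNorm G σ d s₀ β := by
  simpa using starNorm_combo_le (G := G) (d := d) hσ hs₀ ha le_rfl β 0

/-- The penalty decomposes along the support of a sparse vector. -/
lemma IsDoubleSparse.exists_starNorm_head (hG : ∀ j k, j ≠ k → Disjoint (G j) (G k))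
    (hσ : 0 ≤ σ) (hs₀ : 1 ≤ s₀) {s : ℕ} (hsm : s ≤ m) {β : EuclideanSpace ℝ (Fin p)}
    (hβ : IsDoubleSparse G s s₀ β) (u : EuclideanSpace ℝ (Fin p)) :
    ∃ H, H ≤ starNorm G σ d s₀ u ∧
      H ≤ 2 * (Real.sqrt (∑ i ∈ Finset.Icc 1 (s * s₀), lamTilde σ d m s₀ i ^ 2) * ‖u‖) ∧
      starNorm G σ d s₀ β + starNorm G σ d s₀ u ≤ starNorm G σ d s₀ (β + u) + 2 * H := by
  classical
  refine ⟨sortedHead (lamTilde σ d m s₀) (s * s₀) (fun l => |u l|)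
    + Real.sqrt s₀ * sortedHead (lam σ d m s₀) s (groupNorm G u), ?_, ?_, ?_⟩
  · rw [starNorm_eq]
    exact add_le_add (sortedHead_le_sortedSum (lamTilde_nonneg hσ _ _ _) (fun _ => abs_nonneg _) _)
      (mul_le_mul_of_nonneg_left (sortedHead_le_sortedSum (lam_nonneg hσ _ _ _)
        (groupNorm_nonneg _) _) (Real.sqrt_nonneg _))
  · have h1 := sortedHead_le (lamTilde σ d m s₀) (s * s₀) fun l => |u l|
    have h2 := sortedHead_le (lam σ d m s₀) s (groupNorm G u)
    have e1 : Real.sqrt (∑ i, |u i| ^ 2) = ‖u‖ := by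
      rw [EuclideanSpace.norm_eq]; rfl
    have e2 : Real.sqrt (∑ j, groupNorm G u j ^ 2) ≤ ‖u‖ :=
      Real.sqrt_le_iff.2 ⟨norm_nonneg _, sum_groupNorm_sq_le hG u⟩
    rw [e1] at h1
    -- The factor √s₀ turns the norm of (λ_1, …, λ_s) into Λ, so the group head obeys the same bound
    -- as the entrywise head.
    have h3 : Real.sqrt s₀ * sortedHead (lam σ d m s₀) s (groupNorm G u)
        ≤ Real.sqrt (∑ i ∈ Finset.Icc 1 (s * s₀), lamTilde σ d m s₀ i ^ 2) * ‖u‖ := by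
      rw [sum_lamTilde_sq hs₀ hsm, Real.sqrt_mul (Nat.cast_nonneg _), mul_assoc]
      refine mul_le_mul_of_nonneg_left (h2.trans ?_) (Real.sqrt_nonneg _)
      exact mul_le_mul_of_nonneg_left e2 (Real.sqrt_nonneg _)
    linarith
  · simp only [starNorm_eq]
    have h1 := sortedSum_add_sortedSum_le (lamTilde_succ_le hσ d m hs₀)
      (fun _ => lamTilde_nonneg hσ _ _ _ _)
      (f := fun l => |β l|) (g := fun l => |u l|) (h := fun l => |(β + u) l|)
      (fun _ => abs_nonneg _) (fun _ => abs_nonneg _) (fun _ => abs_nonneg _) (fun i => by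
        simpa using abs_sub (β i + u i) (u i))
      (S := Finset.univ.filter fun i => β i ≠ 0) (q := s * s₀) (by
        have := hβ.2
        rwa [Set.ncard_eq_toFinset_card', Set.toFinset_ofPred] at this)
      (fun i hi => by simpa using hi) (fun i hi => by
        have : β i = 0 := by simpa using hi
        simp [this])
    have h2 := sortedSum_add_sortedSum_le (w := lam σ d m s₀)
      (fun i => lam_le_lam hσ d m s₀ (Nat.le_add_left 1 i) (Nat.le_succ _))
      (fun _ => lam_nonneg hσ _ _ _ _)
      (groupNorm_nonneg (G := G) β) (groupNorm_nonneg u) (groupNorm_nonneg (β + u)) (fun j => by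
        have := groupNorm_combo_le (G := G) zero_le_one zero_le_one (β + u) (-u) j
        simpa [groupNorm_neg] using this)
      (S := Finset.univ.filter fun j => ∃ i ∈ G j, β i ≠ 0) (q := s) (by
        have := hβ.1
        rwa [Set.ncard_eq_toFinset_card', Set.toFinset_ofPred] at this)
      (fun j hj => by
        have hj : ∀ i ∈ G j, β i = 0 := by simpa using hj
        rw [groupNorm_congr (u := 0) hj]
        simp [groupNorm])
      (fun j hj => by
        have hj : ∀ i ∈ G j, β i = 0 := by simpa using hj
        refine le_of_eq (groupNorm_congr fun i hi => ?_)
        simp [hj i hi])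
    have h3 := mul_le_mul_of_nonneg_left h2 (Real.sqrt_nonneg (s₀ : ℝ))
    linarith

end StarNorm

lemma empNorm_sq (v : Fin n → ℝ) : empNorm v ^ 2 = 1 / (n : ℝ) * (v ⬝ᵥ v) := by
  rw [empNorm, Real.sq_sqrt (by positivity)]
  simp [dotProduct, pow_two]

/-- The basic inequality for sparse group SLOPE estimators. -/
lemma IsSparseGroupSlope.basic_inequality {X : Matrix (Fin n) (Fin p) ℝ} {σ γ : ℝ}
    {d s₀ : ℕ} (hσ : 0 ≤ σ) (hs₀ : 1 ≤ s₀) (hγ : 0 < γ) {β b : EuclideanSpace ℝ (Fin p)}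
    {x : Fin n → ℝ} (hb : IsSparseGroupSlope X G σ γ d s₀ (X *ᵥ β.ofLp + x) b) :
    empNorm (X *ᵥ (b - β).ofLp) ^ 2 ≤ 1 / (n : ℝ) * (x ⬝ᵥ (X *ᵥ (b - β).ofLp))
      + (4 + Real.sqrt 2) / (γ * Real.sqrt n) * (starNorm G σ d s₀ β - starNorm G σ d s₀ b) := by
  set v := X *ᵥ (b - β).ofLp with hv
  set r := 2 * (4 + Real.sqrt 2) / (Real.sqrt n * γ) with hr
  have hr0 : 0 ≤ r := by positivity
  -- Comparing b with points on the segment towards β, instead of β itself, gives the first-order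
  -- condition as ε → 0; this doubles the quadratic term on the favourable side.
  have step : ∀ ε : ℝ, 0 < ε → ε ≤ 1 →
      0 ≤ 2 * (1 / (n : ℝ) * (x ⬝ᵥ v)) - 2 * empNorm v ^ 2 + ε * empNorm v ^ 2
        + r * (starNorm G σ d s₀ β - starNorm G σ d s₀ b) := by
    intro ε hε hε1
    have h := hb (Set.mem_univ ((1 - ε) • b + ε • β))
    simp only [Set.mem_ofPred_eq, penalty] at h
    have h1 := starNorm_combo_le (G := G) (d := d) hσ hs₀ (sub_nonneg.2 hε1) hε.le b β
    have h2 := mul_le_mul_of_nonneg_left h1 hr0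
    have e1 : X *ᵥ β.ofLp + x - X *ᵥ b.ofLp = x - v := by
      rw [hv, WithLp.ofLp_sub, Matrix.mulVec_sub]; abel
    have e2 : X *ᵥ β.ofLp + x - X *ᵥ ((1 - ε) • b + ε • β).ofLp = x - (1 - ε) • v := by
      have : ((1 - ε) • b + ε • β).ofLp = β.ofLp + (1 - ε) • (b - β).ofLp := by
        ext i
        simp
        ring
      rw [this, Matrix.mulVec_add, Matrix.mulVec_smul]; abel
    rw [e1, e2] at h
    have q : ∀ c : ℝ, empNorm (x - c • v) ^ 2
        = 1 / (n : ℝ) * (x ⬝ᵥ x) - 2 * c * (1 / (n : ℝ) * (x ⬝ᵥ v)) + c ^ 2 * empNorm v ^ 2 := by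
      intro c
      rw [empNorm_sq, empNorm_sq]
      simp only [sub_dotProduct, dotProduct_sub, smul_dotProduct, dotProduct_smul, smul_eq_mul]
      rw [dotProduct_comm v x]
      ring
    have q1 := q 1
    rw [one_smul] at q1
    rw [q1, q (1 - ε)] at h
    refine le_of_mul_le_mul_left (a := ε) ?_ hε
    nlinarith
  have hlim : 0 ≤ 2 * (1 / (n : ℝ) * (x ⬝ᵥ v)) - 2 * empNorm v ^ 2
        + r * (starNorm G σ d s₀ β - starNorm G σ d s₀ b) := by
    by_contra hneg
    push Not at hneg
    set Q := 2 * (1 / (n : ℝ) * (x ⬝ᵥ v)) - 2 * empNorm v ^ 2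
        + r * (starNorm G σ d s₀ β - starNorm G σ d s₀ b)
    have hE : 0 ≤ empNorm v ^ 2 := sq_nonneg _
    -- This ε makes ε‖v‖ₙ² at most −Q/2, contradicting 0 ≤ Q + ε‖v‖ₙ² without passing to a limit.
    set ε := min 1 (-Q / (2 * (empNorm v ^ 2 + 1))) with hε
    have hε0 : 0 < ε := lt_min one_pos (div_pos (by linarith) (by linarith))
    have hs := step ε hε0 (min_le_left _ _)
    have h1 : ε * (2 * (empNorm v ^ 2 + 1)) ≤ -Q :=
      (le_div_iff₀ (by linarith)).1 (min_le_right _ _)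
    nlinarith
  have hr2 : r = 2 * ((4 + Real.sqrt 2) / (γ * Real.sqrt n)) := by
    rw [hr, mul_comm γ, mul_div_assoc]
  rw [hr2] at hlim
  linarith

lemma theta_mul_norm_le {X : Matrix (Fin n) (Fin p) ℝ} {σ c₀ : ℝ} {d s s₀ : ℕ}
    {u : EuclideanSpace ℝ (Fin p)} (hu : u ∈ wsgreCone G σ d s s₀ c₀) (hu0 : u ≠ 0) :
    theta X G σ d s s₀ c₀ * ‖u‖ ≤ empNorm (X *ᵥ u.ofLp) := by
  rw [← le_div_iff₀ (norm_pos_iff.2 hu0)]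
  refine csInf_le ⟨0, ?_⟩ ⟨u, ⟨hu, hu0⟩, rfl⟩
  rintro _ ⟨w, _, rfl⟩
  exact div_nonneg (Real.sqrt_nonneg _) (norm_nonneg _)

/-- Rescale u to envelope 1. If the envelope vanishes, every nonnegative multiple of u is
admissible, so the left side must be 0; definiteness of the norm is not needed. -/
lemma NoiseEvent.abs_le {X : Matrix (Fin n) (Fin p) ℝ} {σ : ℝ} {d s₀ : ℕ} (hσ : 0 ≤ σ)
    (hs₀ : 1 ≤ s₀) {z : Fin n → ℝ} (hz : NoiseEvent X G σ d s₀ z)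
    (u : EuclideanSpace ℝ (Fin p)) :
    |1 / (n : ℝ) * (z ⬝ᵥ (X *ᵥ u.ofLp))| ≤ 4 * envelope n G σ d s₀ u := by
  have hsc : ∀ c : ℝ, 0 ≤ c → c * envelope n G σ d s₀ u ≤ 1 →
      c * |1 / (n : ℝ) * (z ⬝ᵥ (X *ᵥ u.ofLp))| ≤ 4 := by
    intro c hc hcu
    have h1 : envelope n G σ d s₀ (c • u) ≤ 1 := by
      refine le_trans ?_ hcu
      rw [envelope_eq, envelope_eq, mul_left_comm]
      exact mul_le_mul_of_nonneg_left (starNorm_smul_le hσ hs₀ hc u) (by positivity)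
    have h2 := hz (c • u) h1
    rwa [WithLp.ofLp_smul, Matrix.mulVec_smul, dotProduct_smul, smul_eq_mul, mul_left_comm,
      abs_mul, abs_of_nonneg hc] at h2
  have hN : 0 ≤ envelope n G σ d s₀ u := by
    rw [envelope_eq]
    exact mul_nonneg (by positivity) (starNorm_nonneg hσ u)
  set Y := |1 / (n : ℝ) * (z ⬝ᵥ (X *ᵥ u.ofLp))|
  have hY : 0 ≤ Y := abs_nonneg _
  rcases hN.eq_or_lt with h0 | h0
  · rw [← h0]
    by_contra hneg
    have hY0 : 0 < Y := by linarith
    have := hsc (5 / Y) (by positivity) (by rw [← h0]; simp)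
    rw [div_mul_cancel₀ _ hY0.ne'] at this
    norm_num at this
  · have := hsc (envelope n G σ d s₀ u)⁻¹ (by positivity) (by rw [inv_mul_cancel₀ h0.ne'])
    rw [inv_mul_le_iff₀ h0] at this
    linarith

end Estimator

/-! ### Scalar form of the error bound -/

/-- Off the cone H is below (1 − γ)S/2, so D ≤ −γS. The basic inequality becomes γκS/4 ≤ τE − E² ≤
τ²/4, and r is at most S/(4Λ₀). -/
lemma error_le_of_not_mem_cone {γ κ Λ Λ₀ r E S H D τ ρ T₂ : ℝ} (hγ : 0 < γ) (hγ1 : γ < 1)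
    (hκ : 0 < κ) (hΛ₀ : 0 < Λ₀) (hΛ₁ : Λ₀ ≤ Λ) (hr : 0 ≤ r)
    (hbasic : E ^ 2 ≤ 3 / 4 * γ * κ * S + τ * E + κ * D) (hD : D ≤ 2 * H - S)
    (hHr : H ≤ 2 * (Λ * r)) (hc : (2 + 2 * (1 + γ) / (1 - γ)) * Λ * r < S)
    (hρ : 29 ≤ (ρ * γ * κ) ^ 2) (hT₂ : T₂ = (1 + γ) * κ * (ρ ^ 2 * τ ^ 2) / (16 * Λ₀)) :
    r ≤ T₂ := by
  have hγ' : 0 < 1 - γ := by linarith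
  have e : 2 + 2 * (1 + γ) / (1 - γ) = 4 / (1 - γ) := by
    field_simp; ring
  rw [e, div_mul_eq_mul_div, div_mul_eq_mul_div, div_lt_iff₀ hγ'] at hc
  have h1 : D ≤ -(γ * S) := by linarith
  have h2 : κ * D ≤ κ * -(γ * S) := mul_le_mul_of_nonneg_left h1 hκ.le
  have h3 : γ * κ * S ≤ τ ^ 2 := by nlinarith [sq_nonneg (E - τ / 2)]
  have h4 : 4 * Λ₀ * r ≤ S * (1 - γ) := by
    have := mul_le_mul_of_nonneg_right hΛ₁ hr
    linarith
  have h5 : γ * κ * (4 * Λ₀ * r) ≤ τ ^ 2 := by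
    have hS : 0 ≤ S := by
      have : 0 ≤ S * (1 - γ) := le_trans (by positivity) h4
      exact nonneg_of_mul_nonneg_left this hγ'
    have h6 : S * (1 - γ) ≤ S := by nlinarith
    exact (mul_le_mul_of_nonneg_left (h4.trans h6) (by positivity)).trans h3
  rw [hT₂, le_div_iff₀ (by positivity)]
  refine le_of_mul_le_mul_left (a := γ ^ 2 * κ) ?_ (by positivity)
  have h7 : γ ^ 2 * κ * (r * (16 * Λ₀)) ≤ 4 * τ ^ 2 := by
    have : γ * (γ * κ * (4 * Λ₀ * r)) ≤ 1 * τ ^ 2 :=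
      mul_le_mul hγ1.le h5 (by positivity) zero_le_one
    linarith
  have h8 : 29 * τ ^ 2 ≤ (ρ * γ * κ) ^ 2 * τ ^ 2 :=
    mul_le_mul_of_nonneg_right hρ (sq_nonneg _)
  have h9 : γ ^ 2 * κ * ((1 + γ) * κ * (ρ ^ 2 * τ ^ 2))
      = (ρ * γ * κ) ^ 2 * τ ^ 2 + γ * ((ρ * γ * κ) ^ 2 * τ ^ 2) := by ring
  have h10 : 0 ≤ γ * ((ρ * γ * κ) ^ 2 * τ ^ 2) := by positivity
  have := sq_nonneg τ
  linarith

/-- The error bound extracted from the basic inequality: `κ` is the penalty level, `S` the penalty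
norm of the error, `r` its Euclidean norm, `E` its prediction norm and `τ` the noise level. -/
lemma error_le_max {γ κ Λ Λ₀ r E S H D τ θ ρ T₁ T₂ : ℝ} (hγ : 0 < γ) (hγ1 : γ < 1) (hκ : 0 < κ)
    (hΛ₀ : 0 < Λ₀) (hΛ₁ : Λ₀ ≤ Λ) (hΛ₂ : Λ ≤ 5 / 4 * Λ₀) (hr : 0 ≤ r) (hE : 0 ≤ E)
    (hτ : 0 < τ) (hθ : 0 < θ) (hbasic : E ^ 2 ≤ 3 / 4 * γ * κ * S + τ * E + κ * D)
    (hD : D ≤ 2 * H - S) (hHS : H ≤ S) (hHr : H ≤ 2 * (Λ * r))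
    (hcone : S ≤ (2 + 2 * (1 + γ) / (1 - γ)) * Λ * r → θ * r ≤ E)
    (hρ : 29 ≤ (ρ * γ * κ) ^ 2)
    (hT₁ : T₁ = (1 + γ) * κ * Λ₀ * (15 / 4) / θ ^ 2)
    (hT₂ : T₂ = (1 + γ) * κ * (ρ ^ 2 * τ ^ 2) / (16 * Λ₀)) :
    r ≤ max T₁ T₂ := by
  have hγ' : 0 < 1 - γ := by linarith
  have hT₁0 : 0 ≤ T₁ := by rw [hT₁]; positivity
  have hT₂0 : 0 ≤ T₂ := by rw [hT₂]; positivity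
  by_cases hc : S ≤ (2 + 2 * (1 + γ) / (1 - γ)) * Λ * r
  · have hθr := hcone hc
    set M := max T₁ T₂ with hM
    have hM1 : T₁ ≤ M := le_max_left _ _
    have hM2 : T₂ ≤ M := le_max_right _ _
    have hM0 : 0 ≤ M := hT₁0.trans hM1
    -- H ≤ S trades the remaining −(1 − 3γ/4)S for −(1 − 3γ/4)H, leaving (1 + 3γ/4)H.
    have h1 : E ^ 2 ≤ τ * E + κ * ((1 + γ) * (5 / 2 * Λ₀ * r)) := by
      have a1 : (1 - 3 / 4 * γ) * H ≤ (1 - 3 / 4 * γ) * S :=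
        mul_le_mul_of_nonneg_left hHS (by linarith)
      have a2 : 3 / 4 * γ * S + D ≤ (1 + 3 / 4 * γ) * H := by linarith
      have a3 : H ≤ 5 / 2 * Λ₀ * r := by
        have := mul_le_mul_of_nonneg_right hΛ₂ hr
        linarith
      have a5 : 0 ≤ 5 / 2 * Λ₀ * r := by positivity
      have a4 : (1 + 3 / 4 * γ) * H ≤ (1 + γ) * (5 / 2 * Λ₀ * r) := by
        nlinarith
      have := mul_le_mul_of_nonneg_left (a2.trans a4) hκ.le
      linarith
    have h2 : θ * E ≤ θ * τ + κ * ((1 + γ) * (5 / 2 * Λ₀)) := by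
      rcases hE.eq_or_lt with h0 | h0
      · rw [← h0]; simp only [mul_zero]; positivity
      · refine le_of_mul_le_mul_right (a := E) ?_ h0
        have := mul_le_mul_of_nonneg_left hθr
          (show 0 ≤ κ * ((1 + γ) * (5 / 2 * Λ₀)) by positivity)
        have := mul_le_mul_of_nonneg_left h1 hθ.le
        nlinarith
    have h3 : r ≤ τ / θ + 2 / 3 * T₁ := by
      have e : τ / θ + 2 / 3 * T₁ = (θ * τ + κ * ((1 + γ) * (5 / 2 * Λ₀))) / θ ^ 2 := by
        rw [hT₁]; field_simp; ring
      rw [e, le_div_iff₀ (by positivity)]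
      nlinarith
    -- τ/θ is compared with the geometric mean of T₁ and T₂: the ratio T₁T₂/(τ/θ)² is at least 4 ·
    -- 29 · 15/64 > 16. Then 1/4 + 2/3 < 1 closes the case; 15/4 in T₁ is 3/2 times the 5/2 from H.
    have h4 : τ / θ ≤ M / 4 := by
      refine (pow_le_pow_iff_left₀ (by positivity) (by positivity) two_ne_zero).1 ?_
      have p1 : T₁ * T₂ ≤ M * M := mul_le_mul hM1 hM2 hT₂0 hM0
      have p2 : 16 * (τ / θ) ^ 2 ≤ T₁ * T₂ := by
        have e : T₁ * T₂ = ((1 + γ) ^ 2 * (ρ * κ) ^ 2 * (15 / 64)) * (τ / θ) ^ 2 := by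
          rw [hT₁, hT₂]; field_simp; ring
        rw [e]
        refine mul_le_mul_of_nonneg_right ?_ (sq_nonneg _)
        have q1 : 29 ≤ (ρ * κ) ^ 2 * γ ^ 2 := by
          rw [← mul_pow]; convert hρ using 2; ring
        have q2 : 4 * γ ^ 2 ≤ (1 + γ) ^ 2 := by nlinarith
        have := mul_le_mul_of_nonneg_left q2 (sq_nonneg (ρ * κ))
        linarith
      have e : (M / 4) ^ 2 = M * M / 16 := by ring
      linarith
    linarith
  · push Not at hc
    refine le_trans ?_ (le_max_right _ _)
    exact error_le_of_not_mem_cone hγ hγ1 hκ hΛ₀ hΛ₁ hr hbasic hD hHr hc hρ hT₂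

/-! ### From the noise event to the theorem -/

lemma isClosed_noiseEvent {n p m : ℕ} (X : Matrix (Fin n) (Fin p) ℝ)
    (G : Fin m → Finset (Fin p)) (σ : ℝ) (d s₀ : ℕ) :
    IsClosed {z : Fin n → ℝ | NoiseEvent X G σ d s₀ z} := by
  simp only [NoiseEvent, Set.ofPred_forall]
  refine isClosed_iInter fun u => isClosed_iInter fun _ => isClosed_le ?_ continuous_const
  simp only [dotProduct]
  fun_prop

/-- If the noise event has probability at least `1/2`, then with probability at least
`1 - δ₀ / 2` the noise is within distance `σ √(8 log (1/δ₀))` of it. -/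
lemma exists_event_near_noiseEvent {Ω : Type*} [MeasurableSpace Ω] (μ : Measure Ω)
    [IsProbabilityMeasure μ] {n : ℕ} {K : Set (Fin n → ℝ)} (hK : MeasurableSet K)
    {σ δ₀ : ℝ} (hσ : 0 < σ) (hδ₀ : 0 < δ₀) (hδ₁ : δ₀ < 1)
    {ξ : Fin n → Ω → ℝ} (hξ : ∀ i, Measurable (ξ i))
    (hlaw : ∀ i, μ.map (ξ i) = gaussianReal 0 (Real.toNNReal (σ ^ 2)))
    (hindep : iIndepFun ξ μ) (hhalf : 1 / 2 ≤ μ.real {ω | (fun i => ξ i ω) ∈ K}) :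
    ∃ A : Set Ω, MeasurableSet A ∧ 1 - δ₀ / 2 ≤ μ.real A ∧ ∀ ω ∈ A, ∃ z ∈ K,
      ∑ i, (ξ i ω - z i) ^ 2 ≤ σ ^ 2 * (8 * Real.log (1 / δ₀)) := by
  set L := Real.log (1 / δ₀) with hLdef
  have hL : 0 < L := Real.log_pos (by rw [lt_div_iff₀ hδ₀]; linarith)
  set v := Real.toNNReal (σ ^ 2) with hv
  have hvσ : (v : ℝ) = σ ^ 2 := Real.coe_toNNReal _ (sq_nonneg _)
  have hv0 : v ≠ 0 := by
    intro h
    rw [h, NNReal.coe_zero] at hvσ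
    exact (pow_pos hσ 2).ne hvσ
  set Z : Ω → Fin n → ℝ := fun ω i => ξ i ω with hZ
  have hZm : Measurable Z := measurable_pi_lambda _ hξ
  have hmap : μ.map Z = Measure.pi fun _ => gaussianReal 0 v := by
    rw [(iIndepFun_iff_map_fun_eq_pi_map fun i => (hξ i).aemeasurable).1 hindep]
    simp_rw [hlaw]
  set t := Real.sqrt (σ ^ 2 * (8 * L)) with ht
  have ht0 : 0 < t := Real.sqrt_pos.2 (by positivity)
  have ht2 : t ^ 2 = σ ^ 2 * (8 * L) := Real.sq_sqrt (by positivity)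
  -- Distances are taken in the Euclidean model, because the metric on `Fin n → ℝ` is the sup
  -- metric.
  set K' : Set (EuclideanSpace ℝ (Fin n)) := WithLp.toLp 2 '' K with hK'
  set D : Set (Fin n → ℝ) := {x | t ≤ Metric.infDist (WithLp.toLp 2 x) K'} with hD
  have hDm : MeasurableSet D := by
    refine measurableSet_le measurable_const ?_
    exact (Metric.continuous_infDist_pt K').measurable.comp
      (PiLp.continuous_toLp 2 _).measurable
  have hdist : ∀ x y : Fin n → ℝ, dist (WithLp.toLp 2 x : EuclideanSpace ℝ (Fin n))
      (WithLp.toLp 2 y) ^ 2 = ∑ i, (x i - y i) ^ 2 := by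
    intro x y
    rw [EuclideanSpace.dist_eq, Real.sq_sqrt (by positivity)]
    simp [Real.dist_eq]
  have hhalf' : 1 / 2 ≤ (Measure.pi fun _ : Fin n => gaussianReal 0 v).real K := by
    rw [← hmap, map_measureReal_apply hZm hK]
    exact hhalf
  have hKne : K.Nonempty := by
    rw [Set.nonempty_iff_ne_empty]
    rintro rfl
    norm_num at hhalf'
  have key := pi_gaussianReal_enlargement hv0 hK hDm ht0 (fun x hx y hy => by
    rw [← hdist]
    exact pow_le_pow_left₀ ht0.le
      (le_trans hx (Metric.infDist_le_dist_of_mem ⟨y, hy, rfl⟩)) 2) hhalf'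
  have hexp : Real.exp (-(t ^ 2 / (8 * v))) = δ₀ := by
    have : -(t ^ 2 / (8 * (v : ℝ))) = Real.log δ₀ := by
      rw [ht2, hvσ, hLdef, one_div, Real.log_inv]
      field_simp
    rw [this, Real.exp_log hδ₀]
  rw [hexp, ← hmap, map_measureReal_apply hZm hDm] at key
  refine ⟨(Z ⁻¹' D)ᶜ, (hZm hDm).compl, ?_, fun ω hω => ?_⟩
  · rw [probReal_compl_eq_one_sub (hZm hDm)]
    linarith
  -- Strict inequality yields a point of K within t even if the infimum is not attained.
  · have hlt : Metric.infDist (WithLp.toLp 2 (Z ω)) K' < t := not_le.1 hω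
    obtain ⟨_, ⟨z, hz, rfl⟩, hzt⟩ := (Metric.infDist_lt_iff (hKne.image _)).1 hlt
    refine ⟨z, hz, ?_⟩
    rw [← ht2]
    exact (hdist (Z ω) z).symm.le.trans (pow_le_pow_left₀ dist_nonneg hzt.le 2)

/-- Write x = z + (x − z): the noise event bounds the first part and Cauchy–Schwarz the second. -/
lemma noise_le_of_near {n p m : ℕ} (hn : 0 < n) {X : Matrix (Fin n) (Fin p) ℝ}
    {G : Fin m → Finset (Fin p)} {σ : ℝ} {d s₀ : ℕ} (hσ : 0 ≤ σ) (hs₀ : 1 ≤ s₀)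
    {x z : Fin n → ℝ} (hz : NoiseEvent X G σ d s₀ z) {R : ℝ}
    (hxz : ∑ i, (x i - z i) ^ 2 ≤ R) (u : EuclideanSpace ℝ (Fin p)) :
    1 / (n : ℝ) * (x ⬝ᵥ (X *ᵥ u.ofLp))
      ≤ 4 * envelope n G σ d s₀ u + Real.sqrt (R / n) * empNorm (X *ᵥ u.ofLp) := by
  have hn' : (0 : ℝ) < n := by exact_mod_cast hn
  set v := X *ᵥ u.ofLp
  have h1 := (le_abs_self _).trans (hz.abs_le hσ hs₀ u)
  have h2 : (x - z) ⬝ᵥ v ≤ Real.sqrt R * Real.sqrt (∑ i, v i ^ 2) := by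
    refine (Real.sum_mul_le_sqrt_mul_sqrt _ _ _).trans ?_
    exact mul_le_mul_of_nonneg_right (Real.sqrt_le_sqrt hxz) (Real.sqrt_nonneg _)
  have h3 : Real.sqrt (R / n) * empNorm v
      = 1 / (n : ℝ) * (Real.sqrt R * Real.sqrt (∑ i, v i ^ 2)) := by
    have hR : 0 ≤ R := le_trans (Finset.sum_nonneg fun i _ => sq_nonneg _) hxz
    rw [empNorm, Real.sqrt_mul (by positivity), Real.sqrt_div hR, Real.sqrt_div zero_le_one,
      Real.sqrt_one]
    have : Real.sqrt n * Real.sqrt n = n := Real.mul_self_sqrt hn'.le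
    have hsn : Real.sqrt n ≠ 0 := (Real.sqrt_pos.2 hn').ne'
    field_simp
    rw [pow_two, this]
    ring
  have h4 := mul_le_mul_of_nonneg_left h2 (show 0 ≤ 1 / (n : ℝ) by positivity)
  rw [sub_dotProduct, mul_sub] at h4
  linarith

/-- The deterministic part: the error bound for every sparse group SLOPE estimator when the noise
is close to the noise event. -/
lemma norm_sub_le_of_near {n p m d s₀ s : ℕ} (hn : 0 < n) (hs₀ : 1 ≤ s₀) (hd : s₀ ≤ d)
    {G : Fin m → Finset (Fin p)} (hG : IsGrouping d G) {X : Matrix (Fin n) (Fin p) ℝ}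
    {β b : EuclideanSpace ℝ (Fin p)} {σ γ L : ℝ} (hσ : 0 < σ) (hγ : 0 < γ) (hγ1 : γ < 1)
    (hL : 0 < L) {x z : Fin n → ℝ} (hz : NoiseEvent X G σ d s₀ z)
    (hxz : ∑ i, (x i - z i) ^ 2 ≤ σ ^ 2 * (8 * L))
    (hb : IsSparseGroupSlope X G σ γ d s₀ (X *ᵥ β.ofLp + x) b) (hs : 1 ≤ s) (hsm : s ≤ m)
    (hβ : IsDoubleSparse G s s₀ β) (hθ : 0 < theta X G σ d s s₀ (2 * (1 + γ) / (1 - γ))) :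
    ‖b - β‖ ≤ (1 + γ) * Real.sqrt (s * s₀) * lamSharp σ γ n d m s s₀ *
      max (2 * (15 / 8) / theta X G σ d s s₀ (2 * (1 + γ) / (1 - γ)) ^ 2)
        (1 / 2 * (L / (Real.log (1 / deltaOf σ γ n (lamSharp σ γ n d m s s₀)) * (s * s₀)))) := by
  have hn' : (0 : ℝ) < n := by exact_mod_cast hn
  have hs' : (0 : ℝ) < s := by exact_mod_cast hs
  have hs₀' : (0 : ℝ) < s₀ := by exact_mod_cast hs₀
  set θ := theta X G σ d s s₀ (2 * (1 + γ) / (1 - γ)) with hθdef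
  set ρ := Real.sqrt n with hρ
  have hρ0 : 0 < ρ := Real.sqrt_pos.2 hn'
  have hρ2 : ρ ^ 2 = n := Real.sq_sqrt hn'.le
  set a := 4 + Real.sqrt 2 with ha
  -- Used twice: 4 ≤ (3/4) · 5.4 bounds the noise by the penalty, and 5.4² ≥ 29 is the condition on
  -- ργκ = a.
  have ha1 : 5.4 ≤ a := by
    have : (1.4 : ℝ) ≤ Real.sqrt 2 := Real.le_sqrt_of_sq_le (by norm_num)
    linarith
  set κ := a / (γ * ρ) with hκ
  have hκ0 : 0 < κ := by positivity
  have haκ : ρ * γ * κ = a := by rw [hκ]; field_simp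
  set l := lam σ d m s₀ s with hl
  have hl0 : 0 < l := lam_pos hσ hs₀ hd hs hsm
  have hsharp : lamSharp σ γ n d m s s₀ = κ * l := by
    rw [lamSharp, hκ, hl, lam]; ring
  set Λ₀ := Real.sqrt (s * s₀) * l with hΛ₀
  have hq0 : 0 < Real.sqrt (s * s₀) := Real.sqrt_pos.2 (by positivity)
  have hq2 : Real.sqrt (s * s₀) ^ 2 = s * s₀ := Real.sq_sqrt (by positivity)
  set τ := Real.sqrt (σ ^ 2 * (8 * L) / n) with hτ
  have hτ0 : 0 < τ := Real.sqrt_pos.2 (by positivity)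
  have hτ2 : τ ^ 2 = σ ^ 2 * (8 * L) / n := Real.sq_sqrt (by positivity)
  have hdelta : Real.log (1 / deltaOf σ γ n (lamSharp σ γ n d m s s₀)) = (l / σ) ^ 2 := by
    rw [deltaOf, one_div, ← Real.exp_neg, Real.log_exp, neg_neg, hsharp]
    congr 1
    rw [← ha, ← hρ, hκ]
    field_simp
  obtain ⟨hΛ₁, hΛ₂⟩ := sqrt_sum_lamTilde_sq_bounds hσ hs₀ hd hs hsm
  obtain ⟨H, hHS, hHr, hHD⟩ := hβ.exists_starNorm_head hG.pairwise_disjoint hσ.le hs₀ hsm (b - β)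
  rw [add_sub_cancel] at hHD
  have hbasic := hb.basic_inequality hσ.le hs₀ hγ
  have hnoise := noise_le_of_near hn hσ.le hs₀ hz hxz (b - β)
  have hS0 := starNorm_nonneg (G := G) (d := d) (s₀ := s₀) hσ.le (b - β)
  rw [envelope_eq] at hnoise
  set S := starNorm G σ d s₀ (b - β) with hS
  have h4 : 4 * (1 / ρ * S) ≤ 3 / 4 * γ * κ * S := by
    rw [← mul_assoc]
    refine mul_le_mul_of_nonneg_right ?_ hS0
    rw [mul_one_div, div_le_iff₀ hρ0]
    linarith
  rw [hdelta, hsharp]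
  have main := error_le_max (D := starNorm G σ d s₀ β - starNorm G σ d s₀ b) (H := H) (S := S)
    (r := ‖b - β‖) (E := empNorm (X *ᵥ (b - β).ofLp)) (ρ := ρ) (τ := τ) (θ := θ)
    hγ hγ1 hκ0 (mul_pos hq0 hl0) hΛ₁ hΛ₂ (norm_nonneg _) (Real.sqrt_nonneg _) hτ0 hθ
    (by linarith) (by linarith) hHS hHr (fun hc => by
      rcases eq_or_ne (b - β) 0 with h0 | h0
      · rw [h0, norm_zero, mul_zero]
        exact Real.sqrt_nonneg _
      · exact theta_mul_norm_le hc h0)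
    (by rw [haκ]; nlinarith) rfl rfl
  refine main.trans (le_of_eq ?_)
  rw [mul_max_of_nonneg _ _ (by positivity)]
  congr 1
  · ring
  -- Here ρ²τ² = 8σ²L, and 8/16 is the factor 1/2 of the second term.
  · generalize Real.sqrt (s * s₀) = w at hq0 hq2 ⊢
    rw [hτ2, hρ2, ← hq2]
    field_simp
    norm_num

end SGSlope

end

theorem mainTheorem2 :
    ∃ C : ℝ, 1 < C ∧ C < 2 ∧
      ∀ {Ω : Type*} [MeasurableSpace Ω] (μ : Measure Ω) [IsProbabilityMeasure μ]
        (n p m d s₀ : ℕ) (_hn : 0 < n) (_hs₀ : 1 ≤ s₀) (_hs₀d : s₀ ≤ d)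
        (G : Fin m → Finset (Fin p)) (_hG : SGSlope.IsGrouping d G)
        (X : Matrix (Fin n) (Fin p) ℝ) (βstar : EuclideanSpace ℝ (Fin p))
        (σ γ δ₀ : ℝ) (_hσ : 0 < σ) (_hγ : 0 < γ ∧ γ < 1) (_hδ₀ : 0 < δ₀ ∧ δ₀ < 1)
        (ξ : Fin n → Ω → ℝ) (_hξ : ∀ i, Measurable (ξ i))
        (_hlaw : ∀ i, μ.map (ξ i) = gaussianReal 0 (Real.toNNReal (σ ^ 2)))
        (_hindep : iIndepFun ξ μ)
        (_hnoise : 1 / 2 ≤ μ.real {ω | SGSlope.NoiseEvent X G σ d s₀ (fun i => ξ i ω)}),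
        ∃ A : Set Ω, MeasurableSet A ∧ 1 - δ₀ / 2 ≤ μ.real A ∧
          ∀ ω ∈ A, ∀ βhat : EuclideanSpace ℝ (Fin p),
            SGSlope.IsSparseGroupSlope X G σ γ d s₀
                (X *ᵥ βstar.ofLp + fun i => ξ i ω) βhat →
            ∀ s : ℕ, 1 ≤ s → s ≤ m →
              SGSlope.IsDoubleSparse G s s₀ βstar →
              0 < SGSlope.theta X G σ d s s₀ (2 * (1 + γ) / (1 - γ)) →
              ‖βhat - βstar‖ ≤
                (1 + γ) * Real.sqrt (s * s₀) * SGSlope.lamSharp σ γ n d m s s₀ *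
                  max (2 * C / SGSlope.theta X G σ d s s₀ (2 * (1 + γ) / (1 - γ)) ^ 2)
                    (1 / 2 * (Real.log (1 / δ₀) /
                      (Real.log (1 / SGSlope.deltaOf σ γ n
                        (SGSlope.lamSharp σ γ n d m s s₀)) * (s * s₀)))) := by
  -- C is half of the constant 15/4 in T₁.
  refine ⟨15 / 8, by norm_num, by norm_num, ?_⟩
  intro Ω _ μ _ n p m d s₀ hn hs₀ hs₀d G hG X βstar σ γ δ₀ hσ hγ hδ₀ ξ hξ hlaw hindep hnoise
  obtain ⟨A, hA, hAμ, hnear⟩ := SGSlope.exists_event_near_noiseEvent μ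
    (SGSlope.isClosed_noiseEvent X G σ d s₀).measurableSet hσ hδ₀.1 hδ₀.2 hξ hlaw hindep hnoise
  refine ⟨A, hA, hAμ, fun ω hω βhat hβ s hs hsm hsparse hθ => ?_⟩
  obtain ⟨z, hz, hxz⟩ := hnear ω hω
  have hL : 0 < Real.log (1 / δ₀) :=
    Real.log_pos (by rw [lt_div_iff₀ hδ₀.1]; linarith [hδ₀.2])
  exact SGSlope.norm_sub_le_of_near hn hs₀ hs₀d hG hσ hγ.1 hγ.2 hL hz hxz hβ hs hsm hsparse hθ
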